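/- For integers $0\le k<n$ and a convex body $K\subset\mathbb{R}^n$ (a compact convex set with nonempty interior), let $$\mathrm{sym}_k(K)=\frac{1}{\mathrm{vol}_n(K)}\,\sup_{\mathcal{L}}\ \mathrm{vol}_n\bigl(K\cap \mathrm{refl}_{\mathcal{L}}(K)\bigr),$$ where $\mathcal{L}$ runs over all $k$-dimensional flats (affine subspaces) of $\mathbb{R}^n$, $\mathrm{refl}_{\mathcal{L}}$ denotes reflection through $\mathcal{L}$, and $\mathrm{vol}_n$ is $n$-dimensional Lebesgue measure. Let $\sigma(n,k)=\inf_K \mathrm{sym}_k(K)$, the infimum being over all convex bodies $K\subset\mathbb{R}^n$. Let $n\ge 2$ and $0\le k<n$ be integers. Then $$\sigma(n+1,k+1)\le\max\bigl\{(2-2^{-1/n})^{-n},\ \sigma(n,k)\bigr\}.$$ In particular, $\sigma(n,n-1)\le\sigma(2,1)\le\frac13(\sqrt2+1)$ for every $n\ge 2$. -/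

import Mathlib

open MeasureTheory

noncomputable section

/-- `kSymmetry k K` is the `k`-symmetry of a set `K ⊂ ℝⁿ`: the largest proportion of the volume of
`K` that is covered by the intersection of `K` with its mirror image in a `k`-dimensional flat
(a nonempty affine subspace of dimension `k`). -/
def kSymmetry {n : ℕ} (k : ℕ) (K : Set (EuclideanSpace ℝ (Fin n))) : ℝ :=
  sSup {r : ℝ | ∃ (L : AffineSubspace ℝ (EuclideanSpace ℝ (Fin n))) (_ : Nonempty L),
    Module.finrank ℝ L.direction = k ∧
    r = volume.real (K ∩ EuclideanGeometry.reflection L '' K) / volume.real K}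

/-- `sigma n k` is the infimum of the `k`-symmetry over all convex bodies in `ℝⁿ`, that is, over
all compact convex sets with nonempty interior. -/
def sigma (n k : ℕ) : ℝ :=
  sInf {s : ℝ | ∃ K : ConvexBody (EuclideanSpace ℝ (Fin n)),
    (interior (K : Set (EuclideanSpace ℝ (Fin n)))).Nonempty ∧
    s = kSymmetry k (K : Set (EuclideanSpace ℝ (Fin n)))}

end

/-! ### Reflections and linear involutions -/

section Involution

variable {V : Type*} [NormedAddCommGroup V] [InnerProductSpace ℝ V] [FiniteDimensional ℝ V]

/-! The upper bounds come from very long bodies. Take a body `D` in `E × ℝ` and stretch it by a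
factor `h` along the last axis. For each `h`, the stretched body has a reflection whose overlap is
at least roughly `sigma (n + 1) (k + 1)`. Pulled back to `D`, this reflection is an affine
involution whose coupling block `b` appears as `h • b` and `h⁻¹ • b`. A definite overlap forces `h •
b` to stay bounded, so `b → 0`. A subsequence then converges to an affine involution of `D` that
either preserves the height or reverses it (`z.2 ↦ s - z.2`). Hence `sigma (n + 1) (k + 1)` is at
most the best overlap share among these two kinds of maps; this is `sigma_le_of_overlap_le`.

For `D` the cone over `K`, a height-preserving limit acts on each section, after rescaling, as a
reflection of `K` in a `k`-flat, so it keeps at most the share `kSymmetry k K`. A height-reversing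
limit is controlled by the section volumes `t ^ n` and `(s - t) ^ n` alone, and a convexity
inequality gives the constant `coneConst n`. Taking the infimum over `K` yields the recursion.

The bound on `sigma 2 1` applies the same principle to a truncated triangle, where both kinds of
overlap have area at most `1/3`.

For `sigma n (n - 1) ≤ sigma 2 1` the recursion is iterated, which requires `coneConst n ≤ sigma 2
1` for `n ≥ 2`. Here `coneConst n ≤ coneConst 2 ≤ π / (3√3)`, and every planar convex body has axial
symmetry at least `π / (3√3)`: its largest inscribed ellipse fills that share, and the reflection in
an axis of the ellipse maps the ellipse to itself. -/

theorem Submodule.trace_reflection (S : Submodule ℝ V) :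
    LinearMap.trace ℝ V (S.reflection.toLinearEquiv : V →ₗ[ℝ] V) =
      2 * Module.finrank ℝ S - Module.finrank ℝ V := by
  have h1 : (S.reflection.toLinearEquiv : V →ₗ[ℝ] V) =
      (2 : ℝ) • (S.starProjection : V →ₗ[ℝ] V) - LinearMap.id := by
    ext x
    simp [Submodule.reflection_apply, two_smul]
  have h2 : LinearMap.IsProj S (S.starProjection : V →ₗ[ℝ] V) :=
    ⟨fun x => by simp, fun x hx => by simpa using Submodule.starProjection_eq_self_iff.2 hx⟩
  rw [h1, map_sub, map_smul, h2.trace, LinearMap.trace_id]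
  simp

/-- `(A + id) / 2` is a projection onto the fixed space, and the rank of a projection is its trace.
The trace is used to encode the dimension of a flat because it passes to limits. -/
theorem LinearMap.finrank_ker_sub_id_of_involutive {A : V →ₗ[ℝ] V} {k : ℕ}
    (hA : ∀ x, A (A x) = x)
    (htr : LinearMap.trace ℝ V A = 2 * k - Module.finrank ℝ V) :
    Module.finrank ℝ (LinearMap.ker (A - LinearMap.id)) = k := by
  have hP : LinearMap.IsProj (LinearMap.ker (A - LinearMap.id))
      ((1 / 2 : ℝ) • (A + LinearMap.id)) := by
    refine ⟨fun x => ?_, fun x hx => ?_⟩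
    · simp [hA, add_comm]
    · have : A x = x := by simpa [sub_eq_zero] using hx
      rw [LinearMap.smul_apply, LinearMap.add_apply, this, LinearMap.id_apply, ← two_smul ℝ x,
        smul_smul]
      norm_num
  have h := hP.trace
  rw [map_smul, map_add, htr, LinearMap.trace_id] at h
  simp at h
  exact_mod_cast h.symm

theorem EuclideanGeometry.exists_reflection_eq {A : V →ₗ[ℝ] V} {k : ℕ} {v : V}
    (hA : ∀ x, A (A x) = x) (hsym : A.IsSymmetric)
    (htr : LinearMap.trace ℝ V A = 2 * k - Module.finrank ℝ V) (hv : A v = -v) :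
    ∃ (L : AffineSubspace ℝ V) (_ : Nonempty L), Module.finrank ℝ L.direction = k ∧
      ∀ y, EuclideanGeometry.reflection L y = A y + v := by
  set S := LinearMap.ker (A - LinearMap.id) with hS
  have hp : (1 / 2 : ℝ) • v ∈ AffineSubspace.mk' ((1 / 2 : ℝ) • v) S :=
    AffineSubspace.self_mem_mk' _ _
  -- Since `A v = -v`, the point `v / 2` is fixed by `y ↦ A y + v`, so the mirror passes through it.
  refine ⟨AffineSubspace.mk' ((1 / 2 : ℝ) • v) S, ⟨⟨_, hp⟩⟩, ?_, fun y => ?_⟩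
  · rw [AffineSubspace.direction_mk']
    exact LinearMap.finrank_ker_sub_id_of_involutive hA htr
  · have hS' : ∀ x, x ∈ S ↔ A x = x := fun x => by simp [hS, sub_eq_zero]
    have : Nonempty (AffineSubspace.mk' ((1 / 2 : ℝ) • v) S) := ⟨⟨_, hp⟩⟩
    have hpr : (EuclideanGeometry.orthogonalProjection
        (AffineSubspace.mk' ((1 / 2 : ℝ) • v) S) y : V) = (1 / 2 : ℝ) • (A y + y + v) := by
      rw [EuclideanGeometry.coe_orthogonalProjection_eq_iff_mem, AffineSubspace.mem_mk',
        AffineSubspace.direction_mk', Submodule.mem_orthogonal]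
      constructor
      · rw [vsub_eq_sub, hS', map_sub, map_smul, map_smul, map_add, map_add, hA, hv]
        module
      · intro u hu
        rw [hS'] at hu
        have h1 : inner ℝ u (A y) = inner ℝ u y := by
          conv_rhs => rw [← hu]
          exact (hsym u y).symm
        have h2 : inner ℝ u v = (0 : ℝ) := by
          have : inner ℝ (A u) v = inner ℝ u (A v) := hsym u v
          rw [hu, hv, inner_neg_right] at this
          linarith
        rw [vsub_eq_sub, inner_sub_right, inner_smul_right, inner_add_right, inner_add_right,
          h1, h2]
        ring
    rw [EuclideanGeometry.reflection_apply', hpr, vsub_eq_sub, vadd_eq_add]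
    module

end Involution

/-! ### Elementary bounds for the symmetry measures -/

section Bounds

variable {n k : ℕ}

theorem kSymmetry_ratio_le_one {K X : Set (EuclideanSpace ℝ (Fin n))} (hK : volume K ≠ ⊤) :
    volume.real (K ∩ X) / volume.real K ≤ 1 :=
  div_le_one_of_le₀ (measureReal_mono Set.inter_subset_left hK) measureReal_nonneg

theorem kSymmetry_bddAbove {K : Set (EuclideanSpace ℝ (Fin n))} (hK : volume K ≠ ⊤) :
    BddAbove {r : ℝ | ∃ (L : AffineSubspace ℝ (EuclideanSpace ℝ (Fin n))) (_ : Nonempty L),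
    Module.finrank ℝ L.direction = k ∧
    r = volume.real (K ∩ EuclideanGeometry.reflection L '' K) / volume.real K} := by
  refine ⟨1, ?_⟩
  rintro r ⟨L, _, _, rfl⟩
  exact kSymmetry_ratio_le_one hK

theorem kSymmetry_nonneg (K : Set (EuclideanSpace ℝ (Fin n))) : 0 ≤ kSymmetry k K := by
  refine Real.sSup_nonneg ?_
  rintro r ⟨L, _, _, rfl⟩
  positivity

theorem reflection_image_eq_preimage (L : AffineSubspace ℝ (EuclideanSpace ℝ (Fin n)))
    [Nonempty L] (K : Set (EuclideanSpace ℝ (Fin n))) :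
    EuclideanGeometry.reflection L '' K = EuclideanGeometry.reflection L ⁻¹' K :=
  congrFun (Set.image_eq_preimage_of_inverse (EuclideanGeometry.reflection_involutive L)
    (EuclideanGeometry.reflection_involutive L)) K

theorem exists_reflection_of_lt_kSymmetry {K : Set (EuclideanSpace ℝ (Fin n))} {M : ℝ}
    (hM0 : 0 ≤ M) (hM : M < kSymmetry k K) :
    ∃ (L : AffineSubspace ℝ (EuclideanSpace ℝ (Fin n))) (_ : Nonempty L),
    Module.finrank ℝ L.direction = k ∧
    M < volume.real (K ∩ EuclideanGeometry.reflection L ⁻¹' K) / volume.real K := by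
  have hne : {r : ℝ | ∃ (L : AffineSubspace ℝ (EuclideanSpace ℝ (Fin n))) (_ : Nonempty L),
      Module.finrank ℝ L.direction = k ∧
      r = volume.real (K ∩ EuclideanGeometry.reflection L '' K) / volume.real K}.Nonempty := by
    by_contra hcon
    rw [Set.not_nonempty_iff_eq_empty] at hcon
    -- If no flat of dimension `k` existed, the supremum would take the default value `0`, which `0
    -- ≤ M` excludes.
    rw [kSymmetry, hcon, Real.sSup_empty] at hM
    linarith
  obtain ⟨r, ⟨L, hL, hfr, rfl⟩, hr⟩ := exists_lt_of_lt_csSup hne hM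
  exact ⟨L, hL, hfr, by rwa [reflection_image_eq_preimage] at hr⟩

theorem measureReal_inter_le_kSymmetry_mul {K : Set (EuclideanSpace ℝ (Fin n))}
    (hK : volume K ≠ ⊤) (hK0 : 0 < volume.real K)
    {A : EuclideanSpace ℝ (Fin n) →ₗ[ℝ] EuclideanSpace ℝ (Fin n)} {v : EuclideanSpace ℝ (Fin n)}
    (hA : ∀ x, A (A x) = x) (hsym : A.IsSymmetric)
    (htr : LinearMap.trace ℝ _ A = 2 * k - n) (hv : A v = -v) :
    volume.real (K ∩ {y | A y + v ∈ K}) ≤ kSymmetry k K * volume.real K := by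
  obtain ⟨L, hL, hfr, hrefl⟩ := EuclideanGeometry.exists_reflection_eq (k := k) hA hsym
    (by rw [htr, finrank_euclideanSpace_fin]) hv
  rw [← div_le_iff₀ hK0]
  refine le_csSup (kSymmetry_bddAbove hK) ⟨L, hL, hfr, ?_⟩
  rw [reflection_image_eq_preimage]
  congr 2
  ext y
  simp [hrefl]

theorem sigma_le_kSymmetry (K : ConvexBody (EuclideanSpace ℝ (Fin n)))
    (hK : (interior (K : Set (EuclideanSpace ℝ (Fin n)))).Nonempty) :
    sigma n k ≤ kSymmetry k (K : Set (EuclideanSpace ℝ (Fin n))) := by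
  refine csInf_le ⟨0, ?_⟩ ⟨K, hK, rfl⟩
  rintro s ⟨K, _, rfl⟩
  exact kSymmetry_nonneg _

theorem sigma_set_nonempty (n k : ℕ) :
    {s : ℝ | ∃ K : ConvexBody (EuclideanSpace ℝ (Fin n)),
    (interior (K : Set (EuclideanSpace ℝ (Fin n)))).Nonempty ∧
    s = kSymmetry k (K : Set (EuclideanSpace ℝ (Fin n)))}.Nonempty :=
  ⟨_, ⟨Metric.closedBall 0 1, convex_closedBall _ _, isCompact_closedBall _ _, ⟨0, by simp⟩⟩,
    ⟨0, mem_interior_iff_mem_nhds.2 (Metric.closedBall_mem_nhds _ one_pos)⟩, rfl⟩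

end Bounds

/-! ### Reflections in product coordinates -/

section Product

variable {n k : ℕ}

/-- The product carries the sup norm, so the Euclidean inner product is transported explicitly
instead of through an isometry. -/
theorem exists_prod_coordinates (n : ℕ) :
    ∃ e : EuclideanSpace ℝ (Fin (n + 1)) ≃L[ℝ] EuclideanSpace ℝ (Fin n) × ℝ,
      ∀ p q, inner ℝ (e.symm p) (e.symm q) = inner ℝ p.1 q.1 + p.2 * q.2 := by
  have hf : Module.finrank ℝ (WithLp 2 (EuclideanSpace ℝ (Fin n) × ℝ)) = n + 1 := by
    rw [(WithLp.linearEquiv 2 ℝ _).finrank_eq]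
    simp
  let b := (stdOrthonormalBasis ℝ (WithLp 2 (EuclideanSpace ℝ (Fin n) × ℝ))).reindex
    (finCongr hf)
  refine ⟨b.repr.symm.toContinuousLinearEquiv.trans (WithLp.prodContinuousLinearEquiv 2 ℝ _ _),
    fun p q => ?_⟩
  change inner ℝ (b.repr (WithLp.toLp 2 p)) (b.repr (WithLp.toLp 2 q)) = _
  rw [LinearIsometryEquiv.inner_map_map, WithLp.prod_inner_apply]
  simp [mul_comm]

theorem trace_prod {E : Type*} [AddCommGroup E] [Module ℝ E] [FiniteDimensional ℝ E]
    (R : (E × ℝ) →ₗ[ℝ] (E × ℝ)) :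
    LinearMap.trace ℝ _ R = LinearMap.trace ℝ _ (LinearMap.fst ℝ E ℝ ∘ₗ R ∘ₗ LinearMap.inl ℝ E ℝ) +
      (R (0, 1)).2 := by
  have h1 : R = (R ∘ₗ LinearMap.inl ℝ E ℝ) ∘ₗ LinearMap.fst ℝ E ℝ +
      (R ∘ₗ LinearMap.inr ℝ E ℝ) ∘ₗ LinearMap.snd ℝ E ℝ := by
    ext <;> simp [← Prod.zero_eq_mk]
  conv_lhs => rw [h1]
  rw [map_add, LinearMap.trace_comp_comm', LinearMap.trace_comp_comm' (LinearMap.snd ℝ E ℝ)]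
  congr 1
  have h2 : LinearMap.snd ℝ E ℝ ∘ₗ R ∘ₗ LinearMap.inr ℝ E ℝ =
      (R (0, 1)).2 • LinearMap.id := by
    ext; simp
  rw [h2]
  simp

/-- A linear map of `E × ℝ` which is an involution and preserves the `ℓ²`-inner product, in block
form. -/
theorem exists_block_form {Q : (EuclideanSpace ℝ (Fin n) × ℝ) →ₗ[ℝ] (EuclideanSpace ℝ (Fin n) × ℝ)}
    (hinv : ∀ z, Q (Q z) = z)
    (hsym : ∀ p q, inner ℝ (Q p).1 q.1 + (Q p).2 * q.2 = inner ℝ p.1 (Q q).1 + p.2 * (Q q).2) :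
    ∃ (A : EuclideanSpace ℝ (Fin n) →L[ℝ] EuclideanSpace ℝ (Fin n))
      (b : EuclideanSpace ℝ (Fin n)) (d : ℝ),
      (∀ z, Q z = (A z.1 + z.2 • b, inner ℝ b z.1 + d * z.2)) ∧
      (A : _ →ₗ[ℝ] EuclideanSpace ℝ (Fin n)).IsSymmetric ∧
      (∀ x, ‖A x‖ ≤ ‖x‖) ∧ (∀ x, A (A x) + inner ℝ b x • b = x) ∧ ‖b‖ ^ 2 + d ^ 2 = 1 ∧
      LinearMap.trace ℝ _ (A : _ →ₗ[ℝ] EuclideanSpace ℝ (Fin n)) + d = LinearMap.trace ℝ _ Q := by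
  set A₀ := LinearMap.fst ℝ _ ℝ ∘ₗ Q ∘ₗ LinearMap.inl ℝ (EuclideanSpace ℝ (Fin n)) ℝ with hA₀
  set b := (Q (0, 1)).1 with hb
  set d := (Q (0, 1)).2 with hd
  have hA₀x : ∀ x, (Q (x, 0)).1 = A₀ x := fun x => by simp [hA₀]
  have h2 : ∀ x, (Q (x, 0)).2 = inner ℝ b x := fun x => by
    rw [real_inner_comm]
    simpa [hb] using hsym (x, 0) (0, 1)
  have hQ : ∀ z, Q z = (A₀ z.1 + z.2 • b, inner ℝ b z.1 + d * z.2) := fun z => by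
    have : z = (z.1, 0) + z.2 • ((0 : EuclideanSpace ℝ (Fin n)), (1 : ℝ)) := by
      ext <;> simp
    conv_lhs => rw [this, map_add, map_smul]
    ext1
    · simp [hA₀x, hb]
    · simp [h2, hd, mul_comm]
  have hAsym : A₀.IsSymmetric := fun x y => by
    simpa [hA₀x] using hsym (x, 0) (y, 0)
  have hAA : ∀ x, A₀ (A₀ x) + inner ℝ b x • b = x := fun x => by
    have h := congrArg Prod.fst (hinv (x, 0))
    rw [hQ, hQ (x, 0)] at h
    simpa using h
  refine ⟨LinearMap.toContinuousLinearMap A₀, b, d, hQ, hAsym, fun x => ?_, hAA, ?_, ?_⟩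
  · have h3 : ‖A₀ x‖ ^ 2 + (inner ℝ b x) ^ 2 = ‖x‖ ^ 2 := by
      have h4 := congrArg (fun y => inner ℝ y x) (hAA x)
      simp only [inner_add_left, inner_smul_left, hAsym (A₀ x) x, real_inner_self_eq_norm_sq] at h4
      simpa [sq] using h4
    have h5 : ‖A₀ x‖ ^ 2 ≤ ‖x‖ ^ 2 := by nlinarith [sq_nonneg (inner ℝ b x)]
    exact (sq_le_sq₀ (norm_nonneg _) (norm_nonneg _)).1 h5
  · have h := congrArg Prod.snd (hinv (0, 1))
    rw [hQ, hQ (0, 1)] at h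
    simpa [sq] using h
  · rw [trace_prod Q]
    rfl

theorem isAddHaarMeasure_volume_prod (n : ℕ) :
    (volume : Measure (EuclideanSpace ℝ (Fin n) × ℝ)).IsAddHaarMeasure := by
  rw [Measure.volume_eq_prod]
  infer_instance

/-- The affine map of `E × ℝ` with the given coefficients. -/
noncomputable def blockMap (A : EuclideanSpace ℝ (Fin n) →L[ℝ] EuclideanSpace ℝ (Fin n))
    (β τ γ : EuclideanSpace ℝ (Fin n)) (d s : ℝ) (z : EuclideanSpace ℝ (Fin n) × ℝ) :
    EuclideanSpace ℝ (Fin n) × ℝ :=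
  (A z.1 + z.2 • β + τ, inner ℝ γ z.1 + d * z.2 + s)

/-- The body tested is `D` stretched by `h` along the axis. Conjugating a reflection with blocks
`A`, `b`, `d` by the stretch multiplies one copy of `b` by `h` and the other by `h⁻¹`. -/
theorem exists_large_overlap {D : Set (EuclideanSpace ℝ (Fin n) × ℝ)} (hcomp : IsCompact D)
    (hconv : Convex ℝ D) (hint : (interior D).Nonempty) {M : ℝ} (hM0 : 0 ≤ M)
    (hM : M < sigma (n + 1) (k + 1)) {h : ℝ} (hh : 0 < h) :
    ∃ (A : EuclideanSpace ℝ (Fin n) →L[ℝ] EuclideanSpace ℝ (Fin n))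
      (b τ : EuclideanSpace ℝ (Fin n)) (d s : ℝ),
      (A : _ →ₗ[ℝ] EuclideanSpace ℝ (Fin n)).IsSymmetric ∧
      (∀ x, ‖A x‖ ≤ ‖x‖) ∧ (∀ x, A (A x) + inner ℝ b x • b = x) ∧ ‖b‖ ^ 2 + d ^ 2 = 1 ∧
      LinearMap.trace ℝ _ (A : _ →ₗ[ℝ] EuclideanSpace ℝ (Fin n)) + d =
        2 * (k + 1) - (n + 1) ∧
      (∀ z, blockMap A (h • b) τ (h⁻¹ • b) d s (blockMap A (h • b) τ (h⁻¹ • b) d s z) = z) ∧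
      M * volume.real D <
        volume.real (D ∩ blockMap A (h • b) τ (h⁻¹ • b) d s ⁻¹' D) := by
  obtain ⟨e, he⟩ := exists_prod_coordinates n
  let S : (EuclideanSpace ℝ (Fin n) × ℝ) ≃L[ℝ] (EuclideanSpace ℝ (Fin n) × ℝ) :=
    (ContinuousLinearEquiv.refl ℝ _).prodCongr
      (ContinuousLinearEquiv.smulLeft (Units.mk0 h⁻¹ (inv_ne_zero hh.ne')))
  have hS : ∀ z, S z = (z.1, h⁻¹ * z.2) := fun z => rfl
  let g := e.trans S
  have hg : ∀ y, g y = ((e y).1, h⁻¹ * (e y).2) := fun y => rfl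
  have hgs : ∀ z, g.symm z = e.symm (z.1, h * z.2) := fun z => by
    rw [ContinuousLinearEquiv.symm_apply_eq, hg]
    ext1 <;> simp [hh.ne']
  let K : ConvexBody (EuclideanSpace ℝ (Fin (n + 1))) :=
    ⟨g ⁻¹' D, hconv.linear_preimage g.toLinearEquiv.toLinearMap,
      g.toHomeomorph.isCompact_preimage.2 hcomp, by
        obtain ⟨z, hz⟩ := hint
        exact ⟨g.symm z, by simpa using interior_subset hz⟩⟩
  have hKD : (K : Set (EuclideanSpace ℝ (Fin (n + 1)))) = g ⁻¹' D := rfl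
  have hKint : (interior (K : Set (EuclideanSpace ℝ (Fin (n + 1))))).Nonempty := by
    rw [hKD, ← g.coe_toHomeomorph, ← g.toHomeomorph.preimage_interior]
    obtain ⟨z, hz⟩ := hint
    exact ⟨g.symm z, by simpa using hz⟩
  have : (Measure.map g volume).IsAddHaarMeasure := g.isAddHaarMeasure_map volume
  have := isAddHaarMeasure_volume_prod n
  -- A linear change of coordinates scales all volumes by one constant, which cancels in the overlap
  -- ratio, so its value is irrelevant.
  obtain ⟨c, hc⟩ : ∃ c : NNReal, Measure.map g volume = c • volume :=
    ⟨_, Measure.isAddLeftInvariant_eq_smul _ _⟩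
  have hvol : ∀ X, volume.real (g ⁻¹' X) = c * volume.real X := fun X => by
    have : volume (g ⁻¹' X) = (Measure.map g volume) X :=
      (g.toHomeomorph.toMeasurableEquiv.map_apply X).symm
    rw [Measure.real, this, hc]
    simp [Measure.real]
  have hKpos : 0 < volume.real (K : Set (EuclideanSpace ℝ (Fin (n + 1)))) := by
    refine ENNReal.toReal_pos (Measure.measure_pos_of_nonempty_interior _ hKint).ne'
      K.isCompact.measure_ne_top
  have hcpos : 0 < (c : ℝ) := by
    rw [hKD, hvol] at hKpos
    exact pos_of_mul_pos_left hKpos measureReal_nonneg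
  have hlt : M < kSymmetry (k + 1) (K : Set (EuclideanSpace ℝ (Fin (n + 1)))) :=
    hM.trans_le (sigma_le_kSymmetry K hKint)
  obtain ⟨L, hL, hfr, hr⟩ := exists_reflection_of_lt_kSymmetry hM0 hlt
  obtain ⟨x, hx⟩ := id hL
  let R₀ : EuclideanSpace ℝ (Fin (n + 1)) ≃ₗᵢ[ℝ] EuclideanSpace ℝ (Fin (n + 1)) :=
    L.direction.reflection
  set p := x - R₀ x with hp
  have hR : ∀ y, EuclideanGeometry.reflection L y = R₀ y + p := fun y => by
    rw [EuclideanGeometry.reflection_apply_of_mem L y hx, vsub_eq_sub, vadd_eq_add, map_sub, hp]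
    change R₀ y - R₀ x + x = _
    abel
  let Q : (EuclideanSpace ℝ (Fin n) × ℝ) →ₗ[ℝ] (EuclideanSpace ℝ (Fin n) × ℝ) :=
    e.toLinearEquiv.conj (R₀.toLinearEquiv : _ →ₗ[ℝ] _)
  have hQ : ∀ z, Q z = e (R₀ (e.symm z)) := fun z => rfl
  obtain ⟨A, b, d, hQA, hAsym, hAnorm, hAA, hbd, htr⟩ := exists_block_form (Q := Q)
    (fun z => by simp [hQ, R₀]) (fun z w => by
      rw [← he, ← he, hQ, hQ, e.symm_apply_apply, e.symm_apply_apply]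
      have h1 := L.direction.reflection.inner_map_map (e.symm z) (R₀ (e.symm w))
      rw [← h1]
      simp [R₀])
  have hT : ∀ z, blockMap A (h • b) (g p).1 (h⁻¹ • b) d (g p).2 z =
      g (EuclideanGeometry.reflection L (g.symm z)) := fun z => by
    rw [hR, map_add, hg (R₀ _), hgs, ← hQ, hQA]
    have hh' := hh.ne'
    ext1
    · simp [blockMap, smul_smul, mul_comm]
    · simp only [blockMap, inner_smul_left, Prod.snd_add]
      simp
      field_simp
  refine ⟨A, b, (g p).1, d, (g p).2, hAsym, hAnorm, hAA, hbd, ?_, fun z => ?_, ?_⟩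
  · rw [htr, LinearMap.trace_conj', Submodule.trace_reflection, hfr, finrank_euclideanSpace_fin]
    push_cast
    ring
  · rw [hT, hT, g.symm_apply_apply, EuclideanGeometry.reflection_reflection, g.apply_symm_apply]
  · rw [lt_div_iff₀ hKpos, hKD] at hr
    have : g ⁻¹' D ∩ EuclideanGeometry.reflection L ⁻¹' (g ⁻¹' D) =
        g ⁻¹' (D ∩ blockMap A (h • b) (g p).1 (h⁻¹ • b) d (g p).2 ⁻¹' D) := by
      ext y
      simp [hT]
    rw [this, hvol, hvol] at hr
    nlinarith

end Product

/-! ### Overlaps of a body with a convergent sequence of its images -/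

section Limit

open Filter Topology

/-- A point that lies in infinitely many of the overlaps lies in the limit overlap because `D` is
closed. The measure of this limsup set is at least `c`, by continuity from above along the
decreasing tail unions. -/
theorem le_measureReal_inter_preimage_of_tendsto {X : Type*} [TopologicalSpace X]
    [MeasurableSpace X] [OpensMeasurableSpace X] {μ : Measure X} {D : Set X} (hD : IsClosed D)
    (hfin : μ D ≠ ⊤) {T : ℕ → X → X} {T₀ : X → X} (hT : ∀ m, Measurable (T m))
    (hlim : ∀ z, Tendsto (fun m => T m z) atTop (𝓝 (T₀ z))) {c : ℝ}
    (hc : ∀ m, c ≤ μ.real (D ∩ T m ⁻¹' D)) : c ≤ μ.real (D ∩ T₀ ⁻¹' D) := by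
  set B : ℕ → Set X := fun N => ⋃ m ≥ N, D ∩ T m ⁻¹' D with hB
  have hBD : ∀ N, B N ⊆ D := fun N => Set.iUnion₂_subset fun m _ => Set.inter_subset_left
  have hanti : Antitone B := fun N N' hNN' =>
    Set.biUnion_subset_biUnion_left fun m (hm : N' ≤ m) => hNN'.trans hm
  have hmeas : ∀ N, MeasurableSet (B N) := fun N =>
    MeasurableSet.iUnion fun m => MeasurableSet.iUnion fun _ =>
      hD.measurableSet.inter (hT m hD.measurableSet)
  have hsub : ⋂ N, B N ⊆ D ∩ T₀ ⁻¹' D := fun z hz => by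
    rw [Set.mem_iInter] at hz
    refine ⟨hBD 0 (hz 0), ?_⟩
    change T₀ z ∈ D
    refine hD.mem_of_frequently_of_tendsto (f := fun m => T m z) (b := atTop) ?_ (hlim z)
    rw [frequently_atTop]
    intro N
    obtain ⟨m, hm, hzm⟩ := Set.mem_iUnion₂.1 (hz N)
    exact ⟨m, hm, hzm.2⟩
  have htend : Tendsto (fun N => μ.real (B N)) atTop (𝓝 (μ.real (⋂ N, B N))) := by
    have h1 : μ (⋂ N, B N) ≠ ⊤ :=
      measure_ne_top_of_subset ((Set.iInter_subset _ 0).trans (hBD 0)) hfin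
    exact (ENNReal.tendsto_toReal h1).comp (tendsto_measure_iInter_atTop
      (fun N => (hmeas N).nullMeasurableSet) hanti ⟨0, measure_ne_top_of_subset (hBD 0) hfin⟩)
  refine (ge_of_tendsto' htend fun N => (hc N).trans ?_).trans
    (measureReal_mono hsub (measure_ne_top_of_subset Set.inter_subset_left hfin))
  exact measureReal_mono (Set.subset_biUnion_of_mem (u := fun m => D ∩ T m ⁻¹' D) (le_refl N))
    (measure_ne_top_of_subset (hBD N) hfin)

variable {n k : ℕ}

theorem exists_separation_of_measureReal (ρ : ℝ) {δ : ℝ} (hδ : 0 < δ) :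
    ∃ η > 0, ∀ S : Set (EuclideanSpace ℝ (Fin n) × ℝ), S ⊆ Metric.closedBall 0 ρ →
      δ ≤ volume.real S → ∃ z ∈ S, ∃ z' ∈ S, η ≤ |z.2 - z'.2| := by
  set V := volume.real (Metric.closedBall (0 : EuclideanSpace ℝ (Fin n)) ρ) with hV
  have hV0 : 0 ≤ V := measureReal_nonneg
  -- A set with no such pair lies in a slab of half-height `η`, of volume at most `2 * η * V < δ`.
  -- The `+ 1` keeps the denominator positive.
  refine ⟨δ / (4 * (V + 1)), by positivity, fun S hS hδS => ?_⟩
  by_contra! hcon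
  obtain ⟨z₀, hz₀⟩ : S.Nonempty := by
    by_contra h
    rw [Set.not_nonempty_iff_eq_empty] at h
    rw [h, measureReal_empty] at hδS
    linarith
  have hsub : S ⊆ Metric.closedBall (0 : EuclideanSpace ℝ (Fin n)) ρ ×ˢ
      Metric.closedBall z₀.2 (δ / (4 * (V + 1))) := fun z hz => by
    have h1 := hS hz
    rw [← Prod.mk_zero_zero, ← closedBall_prod_same] at h1
    exact ⟨h1.1, by rw [Metric.mem_closedBall, Real.dist_eq]; exact (hcon z hz z₀ hz₀).le⟩
  have h2 := measureReal_mono (μ := volume) hsub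
    ((isCompact_closedBall _ _).prod (isCompact_closedBall _ _)).measure_ne_top
  rw [Measure.volume_eq_prod, measureReal_prod_prod, ← hV, Real.volume_real_closedBall
    (by positivity)] at h2
  rw [Measure.volume_eq_prod] at hδS
  have h3 : V * (2 * (δ / (4 * (V + 1)))) < δ := by
    have : V * (2 * (δ / (4 * (V + 1)))) = δ * (V / (2 * (V + 1))) := by field_simp; ring
    rw [this]
    have : V / (2 * (V + 1)) < 1 := by rw [div_lt_one (by positivity)]; linarith
    nlinarith
  linarith

theorem continuous_blockMap (A : EuclideanSpace ℝ (Fin n) →L[ℝ] EuclideanSpace ℝ (Fin n))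
    (β τ γ : EuclideanSpace ℝ (Fin n)) (d s : ℝ) : Continuous (blockMap A β τ γ d s) := by
  unfold blockMap
  fun_prop

/-- Comparing the images of two points whose heights differ by at least `η` isolates `(z.2 - z'.2) •
β`; once `β` is bounded, so is the translation. -/
theorem norm_coeff_le {ρ η : ℝ} (hη : 0 < η) {D : Set (EuclideanSpace ℝ (Fin n) × ℝ)}
    (hD : D ⊆ Metric.closedBall 0 ρ)
    {A : EuclideanSpace ℝ (Fin n) →L[ℝ] EuclideanSpace ℝ (Fin n)}
    {β τ γ : EuclideanSpace ℝ (Fin n)} {d s : ℝ} (hA : ∀ x, ‖A x‖ ≤ ‖x‖) (hγ : ‖γ‖ ≤ 1)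
    (hd : |d| ≤ 1) {z z' : EuclideanSpace ℝ (Fin n) × ℝ} (hz : z ∈ D) (hz' : z' ∈ D)
    (hTz : blockMap A β τ γ d s z ∈ D) (hTz' : blockMap A β τ γ d s z' ∈ D)
    (hsep : η ≤ |z.2 - z'.2|) :
    ‖β‖ ≤ 4 * ρ / η ∧ ‖τ‖ ≤ 2 * ρ + ρ * (4 * ρ / η) ∧ |s| ≤ 3 * ρ := by
  have hb : ∀ w ∈ D, ‖w.1‖ ≤ ρ ∧ |w.2| ≤ ρ := fun w hw => by
    have := hD hw
    rw [mem_closedBall_zero_iff, Prod.norm_def] at this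
    exact ⟨(le_max_left _ _).trans this, (le_max_right _ _).trans this⟩
  obtain ⟨h1, h2⟩ := hb z hz
  obtain ⟨h1', h2'⟩ := hb z' hz'
  obtain ⟨h3, h4⟩ := hb _ hTz
  obtain ⟨h3', h4'⟩ := hb _ hTz'
  simp only [blockMap] at h3 h4 h3' h4'
  have hρ : 0 ≤ ρ := (norm_nonneg _).trans h1
  have hβ : ‖β‖ ≤ 4 * ρ / η := by
    rw [le_div_iff₀ hη]
    have e : (z.2 - z'.2) • β = ((A z.1 + z.2 • β + τ) - (A z'.1 + z'.2 • β + τ)) -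
        (A z.1 - A z'.1) := by module
    have : ‖(z.2 - z'.2) • β‖ ≤ (ρ + ρ) + (ρ + ρ) := by
      rw [e]
      refine (norm_sub_le _ _).trans (add_le_add ((norm_sub_le _ _).trans (add_le_add h3 h3'))
        ((norm_sub_le _ _).trans (add_le_add ((hA _).trans h1) ((hA _).trans h1'))))
    rw [norm_smul, Real.norm_eq_abs] at this
    nlinarith [norm_nonneg β]
  refine ⟨hβ, ?_, ?_⟩
  · have e : τ = (A z.1 + z.2 • β + τ) - A z.1 - z.2 • β := by module
    have : ‖τ‖ ≤ ρ + ρ + ρ * (4 * ρ / η) := by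
      rw [e]
      refine (norm_sub_le _ _).trans (add_le_add ((norm_sub_le _ _).trans
        (add_le_add h3 ((hA _).trans h1))) ?_)
      rw [norm_smul]
      exact mul_le_mul h2 hβ (norm_nonneg _) hρ
    linarith
  · have h5 : |inner ℝ γ z.1| ≤ ρ :=
      (abs_real_inner_le_norm _ _).trans (by nlinarith [norm_nonneg γ, norm_nonneg z.1])
    have h6 : |d * z.2| ≤ ρ := by
      rw [abs_mul]; nlinarith [abs_nonneg d, abs_nonneg z.2]
    rw [abs_le] at *
    constructor <;> linarith

/-- The limit principle for stretch factors tending to infinity. `hP` handles limits that preserve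
the height and `hF` those that reverse it. -/
theorem sigma_le_of_overlap_le {D : Set (EuclideanSpace ℝ (Fin n) × ℝ)} (hcomp : IsCompact D)
    (hconv : Convex ℝ D) (hint : (interior D).Nonempty) {M : ℝ} (hM0 : 0 ≤ M)
    (hP : ∀ A : EuclideanSpace ℝ (Fin n) →L[ℝ] EuclideanSpace ℝ (Fin n),
      (A : _ →ₗ[ℝ] EuclideanSpace ℝ (Fin n)).IsSymmetric → (∀ x, A (A x) = x) →
      LinearMap.trace ℝ _ (A : _ →ₗ[ℝ] EuclideanSpace ℝ (Fin n)) = 2 * k - n →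
      ∀ β τ, A β = -β → A τ = -τ →
        volume.real (D ∩ {z | (A z.1 + z.2 • β + τ, z.2) ∈ D}) ≤ M * volume.real D)
    (hF : ∀ A : EuclideanSpace ℝ (Fin n) →L[ℝ] EuclideanSpace ℝ (Fin n), (∀ x, A (A x) = x) →
      ∀ β τ s, volume.real (D ∩ {z | (A z.1 + z.2 • β + τ, s - z.2) ∈ D}) ≤ M * volume.real D) :
    sigma (n + 1) (k + 1) ≤ M := by
  by_contra! hcon
  obtain ⟨M', hMM', hM'⟩ := exists_between hcon
  have := isAddHaarMeasure_volume_prod n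
  have hvol : 0 < volume.real D :=
    ENNReal.toReal_pos (Measure.measure_pos_of_nonempty_interior _ hint).ne' hcomp.measure_ne_top
  have hM'0 : 0 < M' := hM0.trans_lt hMM'
  obtain ⟨ρ, hρ⟩ := hcomp.isBounded.subset_closedBall 0
  obtain ⟨η, hη, hsep⟩ := exists_separation_of_measureReal (n := n) ρ (mul_pos hM'0 hvol)
  have hpos : ∀ m : ℕ, (0 : ℝ) < m + 1 := fun m => by positivity
  choose A b τ d s hsym hA hAA hbd htr hinv hlarge using fun m : ℕ =>
    exists_large_overlap hcomp hconv hint hM'0.le hM' (hpos m)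
  set h : ℕ → ℝ := fun m => m + 1 with hh
  have hb1 : ∀ m, ‖b m‖ ≤ 1 := fun m => by
    nlinarith [hbd m, sq_nonneg (d m), norm_nonneg (b m)]
  have hd1 : ∀ m, |d m| ≤ 1 := fun m => by
    rw [← sq_le_one_iff_abs_le_one]
    nlinarith [hbd m, sq_nonneg ‖b m‖]
  have hinv1 : ∀ m, (h m)⁻¹ ≤ 1 := fun m => inv_le_one_of_one_le₀ (by simp [hh])
  have hγ1 : ∀ m, ‖(h m)⁻¹ • b m‖ ≤ 1 := fun m => by
    rw [norm_smul, Real.norm_of_nonneg (inv_nonneg.2 (hpos m).le)]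
    exact mul_le_one₀ (hinv1 m) (norm_nonneg _) (hb1 m)
  have hcoef : ∀ m, ‖h m • b m‖ ≤ 4 * ρ / η ∧ ‖τ m‖ ≤ 2 * ρ + ρ * (4 * ρ / η) ∧
      |s m| ≤ 3 * ρ := fun m => by
    obtain ⟨z, hz, z', hz', hzz'⟩ := hsep _ (Set.inter_subset_left.trans hρ) (hlarge m).le
    exact norm_coeff_le hη hρ (hA m) (hγ1 m) (hd1 m) hz.1 hz'.1 hz.2 hz'.2 hzz'
  let p : ℕ → (EuclideanSpace ℝ (Fin n) →L[ℝ] EuclideanSpace ℝ (Fin n)) ×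
      EuclideanSpace ℝ (Fin n) × EuclideanSpace ℝ (Fin n) × ℝ × ℝ :=
    fun m => (A m, h m • b m, τ m, d m, s m)
  have hpb : ∀ m, p m ∈ Metric.closedBall 0 1 ×ˢ Metric.closedBall 0 (4 * ρ / η) ×ˢ
      Metric.closedBall 0 (2 * ρ + ρ * (4 * ρ / η)) ×ˢ Metric.closedBall 0 1 ×ˢ
        Metric.closedBall 0 (3 * ρ) := fun m => by
    simp only [Set.mem_prod, mem_closedBall_zero_iff, Real.norm_eq_abs, p]
    exact ⟨(A m).opNorm_le_bound zero_le_one (by simpa using hA m), (hcoef m).1, (hcoef m).2.1,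
      hd1 m, (hcoef m).2.2⟩
  have : ProperSpace (EuclideanSpace ℝ (Fin n) →L[ℝ] EuclideanSpace ℝ (Fin n)) :=
    FiniteDimensional.proper_real _
  obtain ⟨⟨A₀, β₀, τ₀, d₀, s₀⟩, -, φ, hφ, hlim⟩ := tendsto_subseq_of_bounded
    (Metric.isBounded_closedBall.prod (Metric.isBounded_closedBall.prod
      (Metric.isBounded_closedBall.prod (Metric.isBounded_closedBall.prod
        Metric.isBounded_closedBall)))) hpb
  have hlA : Tendsto (fun m => A (φ m)) atTop (𝓝 A₀) := hlim.fst_nhds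
  have hlβ : Tendsto (fun m => h (φ m) • b (φ m)) atTop (𝓝 β₀) := hlim.snd_nhds.fst_nhds
  have hlτ : Tendsto (fun m => τ (φ m)) atTop (𝓝 τ₀) := hlim.snd_nhds.snd_nhds.fst_nhds
  have hld : Tendsto (fun m => d (φ m)) atTop (𝓝 d₀) := hlim.snd_nhds.snd_nhds.snd_nhds.fst_nhds
  have hls : Tendsto (fun m => s (φ m)) atTop (𝓝 s₀) := hlim.snd_nhds.snd_nhds.snd_nhds.snd_nhds
  have hlh : Tendsto (fun m => (h (φ m))⁻¹) atTop (𝓝 0) :=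
    (tendsto_inv_atTop_zero.comp (tendsto_natCast_atTop_atTop.atTop_add
      (tendsto_const_nhds (x := (1 : ℝ))))).comp hφ.tendsto_atTop
  -- Boundedness of `h • b` with `h → ∞` kills `b`. The relations `A² + b bᵀ = 1` and `‖b‖² + d² =
  -- 1` then become `A₀² = 1` and `d₀ = ±1`.
  have hlb : Tendsto (fun m => b (φ m)) atTop (𝓝 0) := by
    have := hlh.smul hlβ
    simpa [smul_smul, fun m => inv_mul_cancel₀ (hpos m).ne', hh] using this
  have hlγ : Tendsto (fun m => (h (φ m))⁻¹ • b (φ m)) atTop (𝓝 0) := by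
    simpa using hlh.smul hlb
  have hlAx : ∀ {y : ℕ → EuclideanSpace ℝ (Fin n)} {y₀}, Tendsto y atTop (𝓝 y₀) →
      Tendsto (fun m => A (φ m) (y m)) atTop (𝓝 (A₀ y₀)) := fun {y y₀} hy =>
    ((isBoundedBilinearMap_apply (𝕜 := ℝ) (E := EuclideanSpace ℝ (Fin n))
      (F := EuclideanSpace ℝ (Fin n))).continuous.tendsto (A₀, y₀)).comp (hlA.prodMk_nhds hy)
  have hlT : ∀ {y : ℕ → EuclideanSpace ℝ (Fin n) × ℝ} {y₀}, Tendsto y atTop (𝓝 y₀) →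
      Tendsto (fun m => blockMap (A (φ m)) (h (φ m) • b (φ m)) (τ (φ m))
        ((h (φ m))⁻¹ • b (φ m)) (d (φ m)) (s (φ m)) (y m)) atTop
        (𝓝 (blockMap A₀ β₀ τ₀ 0 d₀ s₀ y₀)) := fun hy =>
    (((hlAx hy.fst_nhds).add (hy.snd_nhds.smul hlβ)).add hlτ).prodMk_nhds
      (((hlγ.inner hy.fst_nhds).add (hld.mul hy.snd_nhds)).add hls)
  have hover : M' * volume.real D ≤
      volume.real (D ∩ blockMap A₀ β₀ τ₀ 0 d₀ s₀ ⁻¹' D) :=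
    le_measureReal_inter_preimage_of_tendsto hcomp.isClosed hcomp.measure_ne_top
      (fun m => (continuous_blockMap _ _ _ _ _ _).measurable)
      (fun z => hlT tendsto_const_nhds) (fun m => (hlarge (φ m)).le)
  have hlt : M * volume.real D < volume.real (D ∩ blockMap A₀ β₀ τ₀ 0 d₀ s₀ ⁻¹' D) :=
    (mul_lt_mul_of_pos_right hMM' hvol).trans_le hover
  have hsym₀ : (A₀ : _ →ₗ[ℝ] EuclideanSpace ℝ (Fin n)).IsSymmetric := fun x y => by
    have h1 : Tendsto (fun m => inner ℝ (A (φ m) x) y) atTop (𝓝 (inner ℝ (A₀ x) y)) :=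
      (hlAx tendsto_const_nhds).inner tendsto_const_nhds
    have h2 : Tendsto (fun m => inner ℝ x (A (φ m) y)) atTop (𝓝 (inner ℝ x (A₀ y))) :=
      tendsto_const_nhds.inner (hlAx tendsto_const_nhds)
    exact tendsto_nhds_unique (h1.congr fun m => hsym (φ m) x y) h2
  have hAA₀ : ∀ x, A₀ (A₀ x) = x := fun x => by
    have h1 := (hlAx (hlAx (y := fun _ => x) tendsto_const_nhds)).add
      ((hlb.inner (𝕜 := ℝ) (tendsto_const_nhds (x := x))).smul hlb)
    have h2 := tendsto_nhds_unique (h1.congr fun m => hAA (φ m) x) tendsto_const_nhds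
    simpa using h2
  have hd₀ : d₀ ^ 2 = 1 := by
    have h1 := ((hlb.norm).pow 2).add (hld.pow 2)
    have h2 := tendsto_nhds_unique (h1.congr fun m => hbd (φ m)) tendsto_const_nhds
    simpa using h2
  have htr₀ : LinearMap.trace ℝ _ (A₀ : _ →ₗ[ℝ] EuclideanSpace ℝ (Fin n)) + d₀ =
      2 * (k + 1) - (n + 1) := by
    let tr : (EuclideanSpace ℝ (Fin n) →L[ℝ] EuclideanSpace ℝ (Fin n)) →ₗ[ℝ] ℝ :=
      LinearMap.trace ℝ _ ∘ₗ ContinuousLinearMap.coeLM ℝ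
    have h1 : Tendsto (fun m => tr (A (φ m))) atTop (𝓝 (tr A₀)) :=
      (tr.continuous_of_finiteDimensional.tendsto A₀).comp hlA
    exact tendsto_nhds_unique ((h1.add hld).congr fun m => htr (φ m)) tendsto_const_nhds
  have hinv₀ : ∀ z, blockMap A₀ β₀ τ₀ 0 d₀ s₀ (blockMap A₀ β₀ τ₀ 0 d₀ s₀ z) = z := fun z => by
    have h1 := hlT (hlT (y := fun _ => z) tendsto_const_nhds)
    exact tendsto_nhds_unique (h1.congr fun m => hinv (φ m) z) tendsto_const_nhds
  rcases mul_self_eq_one_iff.1 ((sq d₀).symm.trans hd₀) with rfl | rfl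
  -- Evaluating the involution identity at heights `0` and `1` separates the conditions on `τ₀` and
  -- `β₀`.
  · have h0 := hinv₀ (0, 0)
    have h1 := hinv₀ (0, 1)
    simp only [blockMap, inner_zero_left, Prod.mk.injEq, map_zero, zero_add, one_mul, zero_smul,
      mul_one, one_smul] at h0 h1
    have hs : s₀ = 0 := by linarith [h0.2]
    subst hs
    have hτ : A₀ τ₀ = -τ₀ := by
      rw [eq_neg_iff_add_eq_zero]
      simpa using h0.1
    have hβ : A₀ β₀ = -β₀ := by
      have h2 := h1.1
      rw [map_add, hτ] at h2
      rw [eq_neg_iff_add_eq_zero, ← h2]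
      module
    refine (hP A₀ hsym₀ hAA₀ (by linarith) β₀ τ₀ hβ hτ).not_gt ?_
    convert! hlt using 4
    ext z
    simp [blockMap]
  · refine (hF A₀ hAA₀ β₀ τ₀ s₀).not_gt ?_
    convert! hlt using 4
    ext z
    simp [blockMap, sub_eq_neg_add]

end Limit

/-! ### Volumes by sections -/

section Sections

variable {n : ℕ}

theorem measure_section_lt_top {S : Set (EuclideanSpace ℝ (Fin n) × ℝ)} (hS : IsCompact S)
    (t : ℝ) : volume {x | (x, t) ∈ S} < ⊤ :=
  (measure_mono fun x hx => ⟨(x, t), hx, rfl⟩ :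
    volume {x | (x, t) ∈ S} ≤ volume (Prod.fst '' S)).trans_lt
    (hS.image continuous_fst).measure_lt_top

theorem volume_eq_lintegral_section {S : Set (EuclideanSpace ℝ (Fin n) × ℝ)} (hS : IsCompact S) :
    volume S = ∫⁻ t, volume {x | (x, t) ∈ S} := by
  rw [Measure.volume_eq_prod, Measure.prod_apply_symm hS.measurableSet]
  rfl

/-- Fubini with a continuous majorant, so no regularity of the section function itself is needed. -/
theorem measureReal_le_integral_of_section_le {S : Set (EuclideanSpace ℝ (Fin n) × ℝ)}
    (hS : IsCompact S) {a b : ℝ} (hab : a ≤ b) (hSab : ∀ z ∈ S, z.2 ∈ Set.Icc a b) {g : ℝ → ℝ}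
    (hg : Continuous g) (h : ∀ t ∈ Set.Icc a b, volume.real {x | (x, t) ∈ S} ≤ g t) :
    volume.real S ≤ ∫ t in a..b, g t := by
  have hg0 : ∀ t ∈ Set.Icc a b, 0 ≤ g t := fun t ht => measureReal_nonneg.trans (h t ht)
  have hi : 0 ≤ ∫ t in a..b, g t := intervalIntegral.integral_nonneg hab hg0
  refine ENNReal.toReal_le_of_le_ofReal hi ?_
  rw [volume_eq_lintegral_section hS, intervalIntegral.integral_of_le hab,
    ← integral_Icc_eq_integral_Ioc, ofReal_integral_eq_lintegral_ofReal
      hg.continuousOn.integrableOn_Icc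
      ((ae_restrict_iff' measurableSet_Icc).2 (Filter.Eventually.of_forall hg0)),
    ← lintegral_indicator measurableSet_Icc]
  refine lintegral_mono fun t => ?_
  by_cases ht : t ∈ Set.Icc a b
  · rw [Set.indicator_of_mem ht]
    exact (ENNReal.le_ofReal_iff_toReal_le (measure_section_lt_top hS t).ne (hg0 t ht)).2 (h t ht)
  · have : {x | (x, t) ∈ S} = ∅ := Set.eq_empty_of_forall_notMem fun x hx => ht (hSab _ hx)
    rw [this]
    simp

theorem integral_le_measureReal_of_le_section {S : Set (EuclideanSpace ℝ (Fin n) × ℝ)}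
    (hS : IsCompact S) {a b : ℝ} (hab : a ≤ b) {g : ℝ → ℝ}
    (hg : Continuous g) (hg0 : ∀ t ∈ Set.Icc a b, 0 ≤ g t)
    (h : ∀ t ∈ Set.Icc a b, g t ≤ volume.real {x | (x, t) ∈ S}) :
    ∫ t in a..b, g t ≤ volume.real S := by
  refine (ENNReal.ofReal_le_iff_le_toReal hS.measure_ne_top).1 ?_
  rw [volume_eq_lintegral_section hS, intervalIntegral.integral_of_le hab,
    ← integral_Icc_eq_integral_Ioc, ofReal_integral_eq_lintegral_ofReal
      hg.continuousOn.integrableOn_Icc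
      ((ae_restrict_iff' measurableSet_Icc).2 (Filter.Eventually.of_forall hg0)),
    ← lintegral_indicator measurableSet_Icc]
  refine lintegral_mono fun t => ?_
  by_cases ht : t ∈ Set.Icc a b
  · rw [Set.indicator_of_mem ht]
    exact (ENNReal.ofReal_le_iff_le_toReal (measure_section_lt_top hS t).ne).2 (h t ht)
  · rw [Set.indicator_of_notMem ht]
    exact zero_le

end Sections

/-! ### Overlaps of a cone-like body with its images that reverse the axis -/

section Flip

/-- The axial symmetry `(2 - 2 ^ (-1 / n)) ^ (-n)` of a cone over an `n`-dimensional base. -/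
noncomputable def coneConst (n : ℕ) : ℝ :=
  ((2 : ℝ) - (2 : ℝ) ^ (-(1 / (n : ℝ)))) ^ (-(n : ℤ))

variable {n : ℕ}

theorem two_rpow_neg_inv_pow (hn : n ≠ 0) : ((2 : ℝ) ^ (-(1 / (n : ℝ)))) ^ n = 1 / 2 := by
  have hn' : (n : ℝ) ≠ 0 := Nat.cast_ne_zero.2 hn
  rw [← Real.rpow_natCast, ← Real.rpow_mul zero_le_two, neg_mul, one_div_mul_cancel hn',
    Real.rpow_neg_one, one_div]

theorem two_rpow_neg_inv_lt_one (hn : n ≠ 0) : (2 : ℝ) ^ (-(1 / (n : ℝ))) < 1 := by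
  have : (0 : ℝ) < n := Nat.cast_pos.2 (Nat.pos_of_ne_zero hn)
  exact Real.rpow_lt_one_of_one_lt_of_neg one_lt_two (neg_neg_of_pos (by positivity))

theorem coneConst_pos (hn : n ≠ 0) : 0 < coneConst n :=
  zpow_pos (by linarith [two_rpow_neg_inv_lt_one hn]) _

/-- With `w = 2 ^ (-1 / n)`, the point `(1 + u) / 2` is the mean of `1 / (2 - w)` and `u / w` with
weights `(2 - w) / 2` and `w / 2`. Convexity of `x ^ (n + 1)` gives the claim, because `w ^ n = 1 /
2` makes the second term exactly `u ^ (n + 1)`. -/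
theorem two_mul_half_add_pow_sub_le (hn : n ≠ 0) {u : ℝ} (hu : 0 ≤ u) :
    2 * ((1 + u) / 2) ^ (n + 1) - 2 * u ^ (n + 1) ≤ coneConst n := by
  set w := (2 : ℝ) ^ (-(1 / (n : ℝ))) with hw
  have hw0 : 0 < w := Real.rpow_pos_of_pos two_pos _
  have hw1 : w < 1 := two_rpow_neg_inv_lt_one hn
  have hwn : w ^ n = 1 / 2 := two_rpow_neg_inv_pow hn
  have h2w : 0 < 2 - w := by linarith
  have hc : coneConst n = (1 / (2 - w)) ^ n := by
    rw [coneConst, ← hw, zpow_neg, zpow_natCast, one_div, inv_pow]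
  have hp : 1 / (2 - w) ∈ Set.Ici (0 : ℝ) := Set.mem_Ici.2 (by positivity)
  have hr : u / w ∈ Set.Ici (0 : ℝ) := Set.mem_Ici.2 (by positivity)
  have hθ : (0 : ℝ) ≤ (2 - w) / 2 := by positivity
  have hθ' : (0 : ℝ) ≤ w / 2 := by positivity
  have hconv := (convexOn_pow (𝕜 := ℝ) (n + 1)).2 hp hr hθ hθ' (by ring)
  simp only [smul_eq_mul] at hconv
  have e1 : (2 - w) / 2 * (1 / (2 - w)) + w / 2 * (u / w) = (1 + u) / 2 := by field_simp
  have e2 : (2 - w) / 2 * (1 / (2 - w)) ^ (n + 1) = coneConst n / 2 := by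
    rw [hc, pow_succ]; field_simp
  have e3 : w / 2 * (u / w) ^ (n + 1) = u ^ (n + 1) := by
    rw [div_pow, pow_succ w, hwn]; field_simp
  rw [e1, e2, e3] at hconv
  linarith

/-- By symmetry about `s / 2` the integral is `2 * ((s / 2) ^ (n + 1) - a ^ (n + 1)) / (n + 1)`. The
preceding inequality applies with `u = s - 1`, or with `u = 0` when `s ≤ 1`. -/
theorem integral_min_pow_le (hn : n ≠ 0) {s a b : ℝ} (ha0 : 0 ≤ a) (has : s - 1 ≤ a)
    (hab : a ≤ b) (hsab : a + b = s) :
    ∫ t in a..b, (min t (s - t)) ^ n ≤ coneConst n / (n + 1) := by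
  have hint : ∀ x y : ℝ, IntervalIntegrable (fun t => (min t (s - t)) ^ n) volume x y :=
    fun x y => Continuous.intervalIntegrable (by fun_prop) _ _
  have h1 : ∫ t in a..(s / 2), (min t (s - t)) ^ n = ∫ t in a..(s / 2), t ^ n := by
    refine intervalIntegral.integral_congr fun t ht => ?_
    rw [Set.uIcc_of_le (by linarith)] at ht
    rw [min_eq_left (by linarith [ht.2])]
  have h2 : ∫ t in (s / 2)..b, (min t (s - t)) ^ n = ∫ t in a..(s / 2), t ^ n := by
    have : ∫ t in (s / 2)..b, (min t (s - t)) ^ n = ∫ t in (s / 2)..b, (s - t) ^ n := by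
      refine intervalIntegral.integral_congr fun t ht => ?_
      rw [Set.uIcc_of_le (by linarith)] at ht
      rw [min_eq_right (by linarith [ht.1])]
    rw [this, intervalIntegral.integral_comp_sub_left (fun t => t ^ n)]
    congr 1 <;> linarith
  rw [← intervalIntegral.integral_add_adjacent_intervals (hint a (s / 2)) (hint _ _), h1, h2,
    integral_pow]
  have hn1 : (0 : ℝ) < n + 1 := by positivity
  rw [← add_div, div_le_div_iff_of_pos_right hn1]
  rcases le_total s 1 with hs | hs
  · have h3 : (s / 2) ^ (n + 1) ≤ ((1 + 0) / 2) ^ (n + 1) :=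
      pow_le_pow_left₀ (by linarith) (by linarith) _
    have h4 := two_mul_half_add_pow_sub_le hn le_rfl
    have h5 : 0 ≤ a ^ (n + 1) := by positivity
    simp at h4 h3 ⊢
    linarith
  · have h3 := two_mul_half_add_pow_sub_le hn (u := s - 1) (by linarith)
    have h4 : (s - 1) ^ (n + 1) ≤ a ^ (n + 1) := pow_le_pow_left₀ (by linarith) has _
    have h5 : (1 + (s - 1)) / 2 = s / 2 := by ring
    rw [h5] at h3
    linarith

/-- The determinant of an involution squares to `1`. -/
theorem measure_preimage_affine_involution
    {A : EuclideanSpace ℝ (Fin n) →L[ℝ] EuclideanSpace ℝ (Fin n)} (hA : ∀ x, A (A x) = x)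
    (v : EuclideanSpace ℝ (Fin n)) (X : Set (EuclideanSpace ℝ (Fin n))) :
    volume {x | A x + v ∈ X} = volume X := by
  have hdet : LinearMap.det (A : _ →ₗ[ℝ] EuclideanSpace ℝ (Fin n)) *
      LinearMap.det (A : _ →ₗ[ℝ] EuclideanSpace ℝ (Fin n)) = 1 := by
    rw [← LinearMap.det_comp, ← LinearMap.det_id (A := ℝ) (M := EuclideanSpace ℝ (Fin n))]
    congr 1
    ext1 x
    exact hA x
  have h1 : |(LinearMap.det (A : _ →ₗ[ℝ] EuclideanSpace ℝ (Fin n)))⁻¹| = 1 := by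
    rcases mul_self_eq_one_iff.1 hdet with h | h <;> simp [h]
  have h2 : {x | A x + v ∈ X} =
      (A : _ →ₗ[ℝ] EuclideanSpace ℝ (Fin n)) ⁻¹' ((fun x => x + v) ⁻¹' X) := rfl
  rw [h2, Measure.addHaar_preimage_linearMap _ (left_ne_zero_of_mul_eq_one hdet), h1,
    measure_preimage_add_right]
  simp

theorem measureReal_inter_flip_le (hn : n ≠ 0) {D : Set (EuclideanSpace ℝ (Fin n) × ℝ)}
    (hD : IsCompact D) (hD01 : ∀ z ∈ D, z.2 ∈ Set.Icc (0 : ℝ) 1) {V : ℝ}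
    (hV : 0 ≤ V)
    (hsec : ∀ t ∈ Set.Icc (0 : ℝ) 1, volume.real {x | (x, t) ∈ D} ≤ V * t ^ n)
    {A : EuclideanSpace ℝ (Fin n) →L[ℝ] EuclideanSpace ℝ (Fin n)} (hA : ∀ x, A (A x) = x)
    (β τ : EuclideanSpace ℝ (Fin n)) (s : ℝ) :
    volume.real (D ∩ {z | (A z.1 + z.2 • β + τ, s - z.2) ∈ D}) ≤
      V * (coneConst n / (n + 1)) := by
  have hc : 0 ≤ V * (coneConst n / (n + 1)) := by
    have := coneConst_pos hn
    positivity
  set S := D ∩ {z | (A z.1 + z.2 • β + τ, s - z.2) ∈ D} with hS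
  have hScomp : IsCompact S := hD.inter_right (hD.isClosed.preimage (by fun_prop))
  -- Both `t` and `s - t` lie in `[0, 1]` only for `t` in `[a, s - a]`.
  set a := max 0 (s - 1) with ha
  set b := s - a with hb
  have ha0 : 0 ≤ a := le_max_left _ _
  have has : s - 1 ≤ a := le_max_right _ _
  have hSab : ∀ z ∈ S, z.2 ∈ Set.Icc a b := fun z hz => by
    obtain ⟨h1, h2⟩ := hD01 _ hz.1
    obtain ⟨h3, h4⟩ := hD01 _ hz.2
    simp only at h3 h4
    refine ⟨max_le h1 (by linarith), ?_⟩
    rw [hb, le_sub_comm]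
    exact max_le h3 (by linarith)
  by_cases hab : a ≤ b
  · have h := measureReal_le_integral_of_section_le hScomp hab hSab
      (g := fun t => V * (min t (s - t)) ^ n) (by fun_prop) (fun t ht => ?_)
    · refine h.trans ?_
      rw [intervalIntegral.integral_const_mul]
      exact mul_le_mul_of_nonneg_left (integral_min_pow_le hn ha0 has hab (by ring)) hV
    · have ht1 : t ∈ Set.Icc (0 : ℝ) 1 := ⟨ha0.trans ht.1, by linarith [ht.2]⟩
      have ht2 : s - t ∈ Set.Icc (0 : ℝ) 1 := ⟨by linarith [ht.2], by linarith [ht.1]⟩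
      rcases le_total t (s - t) with hle | hle
      · rw [min_eq_left hle]
        exact (measureReal_mono (fun x hx => hx.1) (measure_section_lt_top hD t).ne).trans
          (hsec t ht1)
      · rw [min_eq_right hle]
        refine le_trans ?_ (hsec _ ht2)
        have h1 := measure_preimage_affine_involution hA (t • β + τ) {x | (x, s - t) ∈ D}
        rw [Measure.real, Measure.real, ← h1]
        refine ENNReal.toReal_mono (h1.trans_lt (measure_section_lt_top hD _)).ne
          (measure_mono fun x hx => ?_)
        have := hx.2
        simpa [add_assoc] using this
  · have : S = ∅ := Set.eq_empty_of_forall_notMem fun z hz =>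
      hab ((hSab z hz).1.trans (hSab z hz).2)
    rw [this, measureReal_empty]
    exact hc

end Flip

/-! ### Cones -/

section Cone

variable {n k : ℕ}

/-- The cone with apex at the origin over `K × {1}`. -/
def cone (K : Set (EuclideanSpace ℝ (Fin n))) : Set (EuclideanSpace ℝ (Fin n) × ℝ) :=
  (fun p : EuclideanSpace ℝ (Fin n) × ℝ => (p.2 • p.1, p.2)) '' K ×ˢ Set.Icc 0 1

theorem isCompact_cone {K : Set (EuclideanSpace ℝ (Fin n))} (hK : IsCompact K) :
    IsCompact (cone K) :=
  (hK.prod isCompact_Icc).image (by fun_prop)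

theorem mem_cone_iff {K : Set (EuclideanSpace ℝ (Fin n))} {x : EuclideanSpace ℝ (Fin n)} {t : ℝ} :
    (x, t) ∈ cone K ↔ (∃ y ∈ K, t • y = x) ∧ t ∈ Set.Icc (0 : ℝ) 1 := by
  constructor
  · rintro ⟨⟨y, t'⟩, ⟨hy, ht⟩, h⟩
    simp only [Prod.mk.injEq] at h
    obtain ⟨h1, rfl⟩ := h
    exact ⟨⟨y, hy, h1⟩, ht⟩
  · rintro ⟨⟨y, hy, h1⟩, ht⟩
    exact ⟨(y, t), ⟨hy, ht⟩, by simp [h1]⟩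

theorem mem_cone_iff_of_pos {K : Set (EuclideanSpace ℝ (Fin n))} {x : EuclideanSpace ℝ (Fin n)}
    {t : ℝ} (ht0 : 0 < t) (ht1 : t ≤ 1) : (x, t) ∈ cone K ↔ t⁻¹ • x ∈ K := by
  rw [mem_cone_iff]
  constructor
  · rintro ⟨⟨y, hy, rfl⟩, -⟩
    rwa [inv_smul_smul₀ ht0.ne']
  · exact fun h => ⟨⟨_, h, smul_inv_smul₀ ht0.ne' _⟩, ht0.le, ht1⟩

theorem convex_cone {K : Set (EuclideanSpace ℝ (Fin n))} (hK : Convex ℝ K) :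
    Convex ℝ (cone K) := by
  rintro ⟨x, t⟩ hx ⟨x', t'⟩ hx' a b ha hb hab
  rw [mem_cone_iff] at hx hx'
  obtain ⟨⟨y, hy, rfl⟩, ht0, ht1⟩ := hx
  obtain ⟨⟨y', hy', rfl⟩, ht0', ht1'⟩ := hx'
  simp only [Prod.smul_mk, Prod.mk_add_mk, smul_eq_mul]
  rw [mem_cone_iff]
  have h0 : 0 ≤ a * t := mul_nonneg ha ht0
  have h0' : 0 ≤ b * t' := mul_nonneg hb ht0'
  refine ⟨?_, by positivity, by nlinarith⟩
  rcases (add_nonneg h0 h0').eq_or_lt with h | h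
  · have e1 : a * t = 0 := by linarith
    have e2 : b * t' = 0 := by linarith
    exact ⟨y, hy, by rw [← h, smul_smul, smul_smul, e1, e2]; simp⟩
  · refine ⟨(a * t / (a * t + b * t')) • y + (b * t' / (a * t + b * t')) • y',
      hK hy hy' (by positivity) (by positivity) (by field_simp), ?_⟩
    rw [smul_add, smul_smul, smul_smul, smul_smul, smul_smul, mul_div_cancel₀ _ h.ne',
      mul_div_cancel₀ _ h.ne']

theorem measureReal_inv_smul_mem {t : ℝ} (ht : 0 < t) (X : Set (EuclideanSpace ℝ (Fin n))) :
    volume.real {x | t⁻¹ • x ∈ X} = t ^ n * volume.real X := by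
  have : {x | t⁻¹ • x ∈ X} = (fun x => t⁻¹ • x) ⁻¹' X := rfl
  rw [this, Measure.real, Measure.addHaar_preimage_smul _ (inv_ne_zero ht.ne')]
  simp [Measure.real, abs_of_pos ht, ht.le]

theorem measureReal_cone_section {K : Set (EuclideanSpace ℝ (Fin n))} (hn : n ≠ 0) {t : ℝ}
    (ht : t ∈ Set.Icc (0 : ℝ) 1) (hK : K.Nonempty) :
    volume.real {x | (x, t) ∈ cone K} = t ^ n * volume.real K := by
  rcases ht.1.eq_or_lt with rfl | h0
  · have h1 : {x | (x, (0 : ℝ)) ∈ cone K} = {(0 : EuclideanSpace ℝ (Fin n))} := by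
      ext x
      obtain ⟨y, hy⟩ := hK
      simp only [Set.mem_ofPred_eq, mem_cone_iff, zero_smul, Set.mem_singleton_iff]
      exact ⟨fun h => h.1.choose_spec.2.symm, fun h => ⟨⟨y, hy, h.symm⟩, by simp⟩⟩
    -- At the apex the section is a single point, which is null only in positive dimension.
    have : Nontrivial (EuclideanSpace ℝ (Fin n)) := by
      have : Nonempty (Fin n) := Fin.pos_iff_nonempty.1 (Nat.pos_of_ne_zero hn)
      infer_instance
    rw [h1, measureReal_def, measure_singleton]
    simp [hn]
  · rw [← measureReal_inv_smul_mem h0]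
    congr 1
    ext x
    exact mem_cone_iff_of_pos h0 ht.2

theorem integral_pow_mul (C : ℝ) (n : ℕ) :
    ∫ t in (0 : ℝ)..1, t ^ n * C = C / (n + 1) := by
  rw [intervalIntegral.integral_mul_const, integral_pow]
  simp
  ring

theorem div_le_measureReal_cone {K : Set (EuclideanSpace ℝ (Fin n))} (hn : n ≠ 0)
    (hKc : IsCompact K) (hK : K.Nonempty) :
    volume.real K / (n + 1) ≤ volume.real (cone K) := by
  rw [← integral_pow_mul]
  refine integral_le_measureReal_of_le_section (isCompact_cone hKc) zero_le_one (by fun_prop)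
    (fun t ht => mul_nonneg (pow_nonneg ht.1 _) measureReal_nonneg) fun t ht => ?_
  rw [measureReal_cone_section hn ht hK]

/-- The frontier of a convex set is null, so a closed convex set of positive volume is more than its
frontier. -/
theorem interior_nonempty_of_measureReal_pos {D : Set (EuclideanSpace ℝ (Fin n) × ℝ)}
    (hD : Convex ℝ D) (hc : IsClosed D) (h : 0 < volume.real D) : (interior D).Nonempty := by
  by_contra hcon
  rw [Set.not_nonempty_iff_eq_empty] at hcon
  have := isAddHaarMeasure_volume_prod n
  have h1 := hD.addHaar_frontier volume
  rw [hc.frontier_eq, hcon, Set.sdiff_empty] at h1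
  rw [measureReal_def, h1] at h
  simp at h

theorem sigma_succ_le_max_kSymmetry (hn : n ≠ 0) (K : ConvexBody (EuclideanSpace ℝ (Fin n)))
    (hK : (interior (K : Set (EuclideanSpace ℝ (Fin n)))).Nonempty) :
    sigma (n + 1) (k + 1) ≤
      max (coneConst n) (kSymmetry k (K : Set (EuclideanSpace ℝ (Fin n)))) := by
  set X := (K : Set (EuclideanSpace ℝ (Fin n))) with hX
  have hXc : IsCompact X := K.isCompact
  have hXpos : 0 < volume.real X :=
    ENNReal.toReal_pos (Measure.measure_pos_of_nonempty_interior _ hK).ne' hXc.measure_ne_top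
  have hcone : volume.real X / (n + 1) ≤ volume.real (cone X) :=
    div_le_measureReal_cone hn hXc K.nonempty
  have hn1 : (0 : ℝ) < n + 1 := by positivity
  have hpos : 0 < volume.real (cone X) := (div_pos hXpos hn1).trans_le hcone
  have hcc := isCompact_cone hXc
  have h01 : ∀ z ∈ cone X, z.2 ∈ Set.Icc (0 : ℝ) 1 := fun z hz => (mem_cone_iff.1 hz).2
  have hc0 := coneConst_pos hn
  refine sigma_le_of_overlap_le hcc (convex_cone K.convex)
    (interior_nonempty_of_measureReal_pos (convex_cone K.convex) hcc.isClosed hpos)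
    (le_max_of_le_left hc0.le) (fun A hsym hA htr β τ hβ hτ => ?_)
    fun A hA β τ s => ?_
  · set S := cone X ∩ {z | (A z.1 + z.2 • β + τ, z.2) ∈ cone X} with hS
    have hScomp : IsCompact S := hcc.inter_right (hcc.isClosed.preimage (by fun_prop))
    have h := measureReal_le_integral_of_section_le hScomp zero_le_one
      (fun z hz => h01 z hz.1) (g := fun t => t ^ n * (kSymmetry k X * volume.real X))
      (by fun_prop) (fun t ht => ?_)
    · refine h.trans ?_
      rw [integral_pow_mul, mul_div_assoc]
      exact mul_le_mul (le_max_right _ _) hcone (by positivity) (le_max_of_le_left hc0.le)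
    · rcases ht.1.eq_or_lt with rfl | h0
      · refine (measureReal_mono (fun x hx => hx.1) (measure_section_lt_top hcc 0).ne).trans ?_
        rw [measureReal_cone_section hn ht K.nonempty]
        simp [hn]
      -- Rescaling the section at height `t` to `K` turns the map into `x ↦ A x + (β + t⁻¹ • τ)`.
      -- This is a reflection in a `k`-flat because `A` negates the translation.
      · have h1 := measureReal_inter_le_kSymmetry_mul (k := k) hXc.measure_ne_top hXpos hA hsym htr
          (v := β + t⁻¹ • τ) (by simp [hβ, hτ]; abel)
        refine le_trans (le_of_eq ?_) (mul_le_mul_of_nonneg_left h1 (pow_nonneg ht.1 n))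
        rw [← measureReal_inv_smul_mem h0]
        congr 1
        ext x
        simp only [hS, Set.mem_ofPred_eq, Set.mem_inter_iff, mem_cone_iff_of_pos h0 ht.2]
        have : t⁻¹ • (A x + t • β + τ) = A (t⁻¹ • x) + (β + t⁻¹ • τ) := by
          rw [smul_add, smul_add, inv_smul_smul₀ h0.ne', map_smul, add_assoc]
        rw [this]
        rfl
  · refine (measureReal_inter_flip_le hn hcc h01 hXpos.le (fun t ht => ?_) hA β τ s).trans ?_
    · rw [measureReal_cone_section hn ht K.nonempty, mul_comm]
    · have : volume.real X * (coneConst n / (n + 1)) =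
        coneConst n * (volume.real X / (n + 1)) := by ring
      rw [this]
      exact mul_le_mul (le_max_left _ _) hcone (by positivity) (le_max_of_le_left hc0.le)

theorem sigma_succ_le_max (hn : n ≠ 0) (k : ℕ) :
    sigma (n + 1) (k + 1) ≤ max (coneConst n) (sigma n k) := by
  by_contra! hcon
  obtain ⟨h1, h2⟩ := max_lt_iff.1 hcon
  obtain ⟨s, ⟨K, hK, rfl⟩, hs⟩ := exists_lt_of_csInf_lt (sigma_set_nonempty n k) h2
  exact (sigma_succ_le_max_kSymmetry (k := k) hn K hK).not_gt (max_lt h1 hs)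

end Cone

/-! ### A planar body with small axial symmetry -/

section Planar

theorem measure_coord_Icc (a b : ℝ) :
    volume {x : EuclideanSpace ℝ (Fin 1) | x 0 ∈ Set.Icc a b} = ENNReal.ofReal (b - a) := by
  have h : MeasurePreserving (fun x : EuclideanSpace ℝ (Fin 1) => x 0) :=
    (volume_preserving_funUnique (Fin 1) ℝ).comp (PiLp.volume_preserving_ofLp (Fin 1))
  rw [← Real.volume_Icc]
  exact h.measure_preimage (s := Set.Icc a b) measurableSet_Icc.nullMeasurableSet

theorem measureReal_coord_Icc (a b : ℝ) :
    volume.real {x : EuclideanSpace ℝ (Fin 1) | x 0 ∈ Set.Icc a b} = max (b - a) 0 := by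
  rw [Measure.real, measure_coord_Icc, ENNReal.toReal_ofReal']

/-- The triangle with vertices `(0, 0)`, `(0, √2)`, `(√2 / 2, √2 / 2)` with the corner above height
`1` cut off. -/
def truncatedTriangle : Set (EuclideanSpace ℝ (Fin 1) × ℝ) :=
  {z | z.2 ∈ Set.Icc (0 : ℝ) 1 ∧ z.1 0 ∈ Set.Icc 0 (min z.2 (√2 - z.2))}

theorem convex_truncatedTriangle : Convex ℝ truncatedTriangle := by
  rintro ⟨x, t⟩ ⟨⟨h1, h2⟩, h3, h4⟩ ⟨x', t'⟩ ⟨⟨h1', h2'⟩, h3', h4'⟩ a b ha hb hab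
  simp only [le_min_iff] at h1 h2 h3 h4 h1' h2' h3' h4'
  simp only [truncatedTriangle, Set.mem_ofPred_eq, Set.mem_Icc, le_min_iff, Prod.smul_mk,
    Prod.mk_add_mk, smul_eq_mul, PiLp.add_apply, PiLp.smul_apply]
  have hs : √2 = a * √2 + b * √2 := by rw [← add_mul, hab, one_mul]
  refine ⟨⟨by positivity, by nlinarith⟩, by positivity, ?_, ?_⟩
  · nlinarith [mul_le_mul_of_nonneg_left h4.1 ha, mul_le_mul_of_nonneg_left h4'.1 hb]
  · nlinarith [mul_le_mul_of_nonneg_left h4.2 ha, mul_le_mul_of_nonneg_left h4'.2 hb]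

theorem isCompact_truncatedTriangle : IsCompact truncatedTriangle := by
  refine Metric.isCompact_of_isClosed_isBounded ?_ ?_
  · have h1 : IsClosed {z : EuclideanSpace ℝ (Fin 1) × ℝ | 0 ≤ z.1 0} :=
      isClosed_le (by fun_prop) (by fun_prop)
    have h2 : IsClosed {z : EuclideanSpace ℝ (Fin 1) × ℝ | z.1 0 ≤ min z.2 (√2 - z.2)} :=
      isClosed_le (by fun_prop) (by fun_prop)
    exact (isClosed_Icc.preimage continuous_snd).inter (h1.inter h2)
  · refine (Metric.isBounded_closedBall (x := 0) (r := 1)).subset ?_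
    rintro ⟨x, t⟩ ⟨⟨h1, h2⟩, h3, h4⟩
    simp only [le_min_iff] at h1 h2 h3 h4
    rw [mem_closedBall_zero_iff, Prod.norm_def, EuclideanSpace.norm_eq]
    simp only [Fin.sum_univ_one, Real.sqrt_sq_eq_abs, Real.norm_eq_abs, sq_abs,
      Fin.isValue, sup_le_iff, abs_le]
    constructor <;> constructor <;> linarith

theorem measureReal_truncatedTriangle_section {t : ℝ} (ht : t ∈ Set.Icc (0 : ℝ) 1) :
    volume.real {x | (x, t) ∈ truncatedTriangle} = min t (√2 - t) := by
  have h1 : {x | (x, t) ∈ truncatedTriangle} =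
      {x : EuclideanSpace ℝ (Fin 1) | x 0 ∈ Set.Icc 0 (min t (√2 - t))} := by
    ext x
    simp [truncatedTriangle, ht.1, ht.2]
  have h2 : (1 : ℝ) ≤ √2 := Real.one_le_sqrt.2 one_le_two
  rw [h1, measureReal_coord_Icc, sub_zero, max_eq_left]
  exact le_min ht.1 (by linarith [ht.2])

theorem le_measureReal_truncatedTriangle : √2 - 1 ≤ volume.real truncatedTriangle := by
  have h2 : (1 : ℝ) ≤ √2 := Real.one_le_sqrt.2 one_le_two
  have h3 : √2 * √2 = 2 := Real.mul_self_sqrt zero_le_two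
  have h4 : √2 ≤ 2 := by nlinarith
  have hint : ∀ x y : ℝ, IntervalIntegrable (fun t => min t (√2 - t)) volume x y :=
    fun x y => Continuous.intervalIntegrable (by fun_prop) _ _
  refine le_trans (le_of_eq ?_) (integral_le_measureReal_of_le_section
    isCompact_truncatedTriangle zero_le_one (g := fun t => min t (√2 - t)) (by fun_prop)
    (fun t ht => le_min ht.1 (by linarith [ht.2]))
    (fun t ht => (measureReal_truncatedTriangle_section ht).ge))
  rw [← intervalIntegral.integral_add_adjacent_intervals (hint 0 (√2 / 2)) (hint _ _)]
  have e1 : ∫ t in (0 : ℝ)..(√2 / 2), min t (√2 - t) = ∫ t in (0 : ℝ)..(√2 / 2), t := by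
    refine intervalIntegral.integral_congr fun t ht => ?_
    rw [Set.uIcc_of_le (by linarith)] at ht
    exact min_eq_left (by linarith [ht.2])
  have e2 : ∫ t in (√2 / 2)..1, min t (√2 - t) = ∫ t in (√2 / 2)..1, (√2 - t) := by
    refine intervalIntegral.integral_congr fun t ht => ?_
    rw [Set.uIcc_of_le (by linarith)] at ht
    exact min_eq_right (by linarith [ht.1])
  rw [e1, e2, intervalIntegral.integral_sub (by simp) (by simp), integral_id,
    integral_id, intervalIntegral.integral_const, smul_eq_mul]
  nlinarith

/-- The first bound is used on the first quarter of `[a, b]`, the second on the middle half and the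
third on the last quarter. With this split the contributions of `p`, `q` and `a` all cancel. -/
theorem integral_le_of_le_three_lines {g : ℝ → ℝ} (hg : Continuous g) {p q a b : ℝ} (hab : a ≤ b)
    (h1 : ∀ t, g t ≤ 2 * t - (p * t + q)) (h2 : ∀ t, g t ≤ p * t + q)
    (h3 : ∀ t, g t ≤ 2 * √2 - 2 * t - (p * t + q)) : ∫ t in a..b, g t ≤ 1 / 3 := by
  obtain ⟨l, hl⟩ : ∃ l, b = a + 4 * l := ⟨(b - a) / 4, by ring⟩
  have hl0 : 0 ≤ l := by linarith
  have hint : ∀ x y : ℝ, IntervalIntegrable g volume x y :=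
    fun x y => hg.intervalIntegrable _ _
  have hlin : ∀ c d x y : ℝ, ∫ t in x..y, (c * t + d) = c * ((y ^ 2 - x ^ 2) / 2) + d * (y - x) :=
    fun c d x y => by
      rw [intervalIntegral.integral_add (Continuous.intervalIntegrable (by fun_prop) _ _) (by simp),
        intervalIntegral.integral_const_mul, integral_id, intervalIntegral.integral_const,
        smul_eq_mul]
      ring
  have hmono : ∀ c d x y : ℝ, x ≤ y → (∀ t, g t ≤ c * t + d) →
      ∫ t in x..y, g t ≤ c * ((y ^ 2 - x ^ 2) / 2) + d * (y - x) := fun c d x y hxy h => by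
    rw [← hlin]
    exact intervalIntegral.integral_mono hxy (hint x y)
      (Continuous.intervalIntegrable (by fun_prop) _ _) h
  have i1 := hmono (2 - p) (-q) a (a + l) (by linarith) fun t => by linarith [h1 t]
  have i2 := hmono p q (a + l) (a + 3 * l) (by linarith) fun t => by linarith [h2 t]
  have i3 := hmono (-2 - p) (2 * √2 - q) (a + 3 * l) b (by linarith) fun t => by linarith [h3 t]
  rw [← intervalIntegral.integral_add_adjacent_intervals (hint a (a + 3 * l)) (hint _ _),
    ← intervalIntegral.integral_add_adjacent_intervals (hint a (a + l)) (hint _ _)]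
  subst hl
  have hs : √2 * √2 = 2 := Real.mul_self_sqrt zero_le_two
  -- The remaining bound is `2√2 * l - 6 * l² = 1/3 - 6 * (l - √2 / 6)²`.
  nlinarith [sq_nonneg (l - √2 / 6)]

theorem measureReal_truncatedTriangle_inter_le (β τ : EuclideanSpace ℝ (Fin 1)) :
    volume.real (truncatedTriangle ∩
      {z | (-z.1 + z.2 • β + τ, z.2) ∈ truncatedTriangle}) ≤ 1 / 3 := by
  set S := truncatedTriangle ∩ {z | (-z.1 + z.2 • β + τ, z.2) ∈ truncatedTriangle} with hS
  have hScomp : IsCompact S := isCompact_truncatedTriangle.inter_right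
    (isCompact_truncatedTriangle.isClosed.preimage (by fun_prop))
  have hSconv : Convex ℝ S := by
    refine convex_truncatedTriangle.inter fun z hz w hw a b ha hb hab => ?_
    have := convex_truncatedTriangle hz hw ha hb hab
    simp only [Set.mem_ofPred_eq]
    convert this using 1
    ext1
    · have : τ = a • τ + b • τ := by rw [← add_smul, hab, one_smul]
      simp only [Prod.fst_add, Prod.smul_fst, Prod.snd_add, Prod.smul_snd, smul_eq_mul]
      nth_rewrite 1 [this]
      module
    · rfl
  set p := β 0
  set q := τ 0
  have hmem : ∀ x t, (x, t) ∈ S → t ∈ Set.Icc (0 : ℝ) 1 ∧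
      x 0 ∈ Set.Icc (max 0 (p * t + q - min t (√2 - t))) (min (min t (√2 - t)) (p * t + q)) := by
    rintro x t ⟨⟨h1, h2, h3⟩, -, h5, h6⟩
    simp only [PiLp.add_apply, PiLp.neg_apply, PiLp.smul_apply, smul_eq_mul] at h5 h6 h2 h3
    rw [mul_comm] at h5 h6
    exact ⟨h1, max_le h2 (by linarith), le_min h3 (by linarith)⟩
  -- At height `t` two intervals of width `f = min t (√2 - t)` overlap, namely `[0, f]` and its
  -- mirror image `[ℓ - f, ℓ]` with `ℓ = p * t + q`. Their common length is at most `ℓ` and at most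
  -- `2 * f - ℓ`.
  set g : ℝ → ℝ := fun t => min (p * t + q) (min (2 * t - (p * t + q))
    (2 * √2 - 2 * t - (p * t + q))) with hg
  have hgc : Continuous g := by fun_prop
  rcases S.eq_empty_or_nonempty with hemp | hne
  · rw [hemp, measureReal_empty]; norm_num
  have hproj : IsCompact (Prod.snd '' S) := hScomp.image continuous_snd
  have hord : (Prod.snd '' S).OrdConnected :=
    (hSconv.linear_image (LinearMap.snd ℝ _ ℝ)).ordConnected
  have hne' := hne.image Prod.snd
  have hsub : ∀ z ∈ S, z.2 ∈ Set.Icc (sInf (Prod.snd '' S)) (sSup (Prod.snd '' S)) :=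
    fun z hz => ⟨csInf_le hproj.bddBelow ⟨z, hz, rfl⟩, le_csSup hproj.bddAbove ⟨z, hz, rfl⟩⟩
  have hle : sInf (Prod.snd '' S) ≤ sSup (Prod.snd '' S) := by
    obtain ⟨z, hz⟩ := hne
    exact (hsub z hz).1.trans (hsub z hz).2
  refine (measureReal_le_integral_of_section_le hScomp hle hsub hgc fun t ht => ?_).trans
    (integral_le_of_le_three_lines (p := p) (q := q) hgc hle
      (fun t => (min_le_right _ _).trans (min_le_left _ _)) (fun t => min_le_left _ _)
      (fun t => (min_le_right _ _).trans (min_le_right _ _)))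
  -- Convexity makes every section between the extreme heights nonempty, so the length formula has
  -- no truncation at `0`.
  obtain ⟨⟨y, t'⟩, hy, rfl⟩ := hord.out (hproj.sInf_mem hne') (hproj.sSup_mem hne') ht
  simp only
  have hy' := (hmem y t' hy).2
  have hle' := hy'.1.trans hy'.2
  have h1 : volume.real {x | (x, t') ∈ S} ≤
      min (min t' (√2 - t')) (p * t' + q) - max 0 (p * t' + q - min t' (√2 - t')) := by
    rw [← max_eq_left (sub_nonneg.2 hle'), ← measureReal_coord_Icc]
    refine measureReal_mono (fun x hx => (hmem x t' hx).2) ?_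
    rw [measure_coord_Icc]
    exact ENNReal.ofReal_ne_top
  refine h1.trans ?_
  have a1 := min_le_left t' (√2 - t')
  have a2 := min_le_right t' (√2 - t')
  have a3 := min_le_left (min t' (√2 - t')) (p * t' + q)
  have a4 := min_le_right (min t' (√2 - t')) (p * t' + q)
  have a5 := le_max_left 0 (p * t' + q - min t' (√2 - t'))
  have a6 := le_max_right 0 (p * t' + q - min t' (√2 - t'))
  refine le_min ?_ (le_min ?_ ?_) <;> linarith

theorem coneConst_one : coneConst 1 = 2 / 3 := by
  norm_num [coneConst, Real.rpow_neg_one]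

theorem sigma_two_one_le : sigma 2 1 ≤ 1 / 3 * (√2 + 1) := by
  have h2 : (1 : ℝ) < √2 := by rw [Real.lt_sqrt zero_le_one]; norm_num
  have h3 : √2 * √2 = 2 := Real.mul_self_sqrt zero_le_two
  have hvol := le_measureReal_truncatedTriangle
  -- The area is at least `√2 - 1`, the reciprocal of `√2 + 1`.
  have hM : 1 / 3 ≤ 1 / 3 * (√2 + 1) * volume.real truncatedTriangle := by nlinarith
  refine sigma_le_of_overlap_le (n := 1) (k := 0) isCompact_truncatedTriangle
    convex_truncatedTriangle (interior_nonempty_of_measureReal_pos convex_truncatedTriangle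
    isCompact_truncatedTriangle.isClosed (by linarith)) (by positivity)
    (fun A hsym hA htr β τ _ _ => ?_) (fun A hA β τ s => ?_)
  · have hker := LinearMap.finrank_ker_sub_id_of_involutive (k := 0)
      (A := (A : _ →ₗ[ℝ] EuclideanSpace ℝ (Fin 1))) hA (by rw [htr]; simp)
    rw [Submodule.finrank_eq_zero] at hker
    have hneg : ∀ x, A x = -x := fun x => by
      have : x + A x ∈ LinearMap.ker
          ((A : _ →ₗ[ℝ] EuclideanSpace ℝ (Fin 1)) - LinearMap.id) := by
        simp [hA, add_comm]
      rw [hker, Submodule.mem_bot] at this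
      exact eq_neg_of_add_eq_zero_right this
    simp only [hneg]
    exact (measureReal_truncatedTriangle_inter_le β τ).trans hM
  · refine (measureReal_inter_flip_le one_ne_zero isCompact_truncatedTriangle (fun z hz => hz.1)
      zero_le_one (fun t ht => ?_) hA β τ s).trans (le_trans ?_ hM)
    · rw [measureReal_truncatedTriangle_section ht, pow_one, one_mul]
      exact min_le_left _ _
    · rw [coneConst_one]
      norm_num

end Planar

/-! ### Planar convex sets in John position -/

section John

open Real Filter Topology

/-- The ellipse with centre `c` and conjugate half-diameters `p`, `q`. -/
def ellipse (c p q : ℂ) : Set ℂ :=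
  {z | ∃ x y : ℝ, x ^ 2 + y ^ 2 ≤ 1 ∧ z = c + x • p + y • q}

/-- The determinant of two vectors of the plane. -/
def wedge (p q : ℂ) : ℝ := p.re * q.im - p.im * q.re

/-- The unit disc has the largest area among all ellipses contained in `K`. -/
structure IsJohnPosition (K : Set ℂ) : Prop where
  closedBall_subset : Metric.closedBall 0 1 ⊆ K
  abs_wedge_le_one : ∀ c p q, ellipse c p q ⊆ K → |wedge p q| ≤ 1

/-- The supporting line of the unit disc at the point with angle `φ` supports `K`. -/
def IsContactAngle (K : Set ℂ) (φ : ℝ) : Prop :=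
  ∀ z ∈ K, z.re * cos φ + z.im * sin φ ≤ 1

theorem add_mul_le_of_sq_le {a b x y r : ℝ} (hr : 0 ≤ r) (hxy : x ^ 2 + y ^ 2 ≤ 1)
    (hab : a ^ 2 + b ^ 2 ≤ r ^ 2) : a * x + b * y ≤ r := by
  refine abs_le_of_sq_le_sq' ?_ hr |>.2
  nlinarith [sq_nonneg (a * y - b * x), sq_nonneg a, sq_nonneg b, sq_nonneg x, sq_nonneg y,
    mul_le_mul hab hxy (by positivity) (by positivity)]

/-- Support function of the ellipse with centre `(s, 0)` and half-axes `1 + s` and `B`. -/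
theorem ellipse_support_le_one {s x₀ X Y B x y : ℝ} (hs : 0 ≤ s) (hs1 : s ≤ 1) (hx₀ : x₀ < 1)
    (hX : X ≤ x₀) (hXY : X ^ 2 + Y ^ 2 = 1) (hB : B ^ 2 = 1 - 2 * s * (x₀ / (1 - x₀)))
    (hxy : x ^ 2 + y ^ 2 ≤ 1) : (s + (1 + s) * x) * X + B * y * Y ≤ 1 := by
  have hX1 : -1 ≤ X := by nlinarith [sq_nonneg Y]
  have h0 : 0 ≤ 1 - s * X := by nlinarith
  have hY : Y ^ 2 = (1 - X) * (1 + X) := by linarith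
  have h1x : 0 < 1 - x₀ := by linarith
  have hkey : (1 - s * X) ^ 2 - ((1 + s) * X) ^ 2 - (B * Y) ^ 2 =
      2 * s * (1 + X) * ((x₀ - X) / (1 - x₀)) := by
    rw [mul_pow B, hB, hY]
    field_simp
    ring
  have h2 : 0 ≤ 2 * s * (1 + X) * ((x₀ - X) / (1 - x₀)) :=
    mul_nonneg (mul_nonneg (by linarith) (by linarith)) (div_nonneg (by linarith) h1x.le)
  have := add_mul_le_of_sq_le (a := (1 + s) * X) (b := B * Y) h0 hxy (by linarith)
  linarith

/-- To first order `(1 + s)² * (1 - 2 * s * κ)` is `1 + 2 * s * (1 - κ)`. -/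
theorem one_lt_mul_of_small {s κ B : ℝ} (hs : 0 < s) (hκ0 : 0 ≤ κ) (hκ : κ < 1)
    (hsκ : s ≤ (1 - κ) / 4) (hB0 : 0 ≤ B) (hB : B ^ 2 = 1 - 2 * s * κ) : 1 < (1 + s) * B := by
  have h1 : 1 < ((1 + s) * B) ^ 2 := by
    rw [mul_pow, hB]
    have : 0 < s * (2 * (1 - κ) + s - 4 * s * κ - 2 * s ^ 2 * κ) := by
      refine mul_pos hs ?_
      have h3 : s * κ ≤ s := by nlinarith
      have h4 : s ^ 2 * κ ≤ s := by nlinarith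
      nlinarith
    linarith
  exact (one_lt_sq_iff₀ (by positivity)).1 h1

theorem exists_angle_of_clm {f : ℂ →L[ℝ] ℝ} (hf : f ≠ 0) (θ : ℝ) :
    ∃ r > 0, ∃ ψ ∈ Set.Ioc (-π) π,
      ∀ z, f z = r * (z.re * cos (θ + ψ) + z.im * sin (θ + ψ)) := by
  set w : ℂ := ⟨f 1, f Complex.I⟩ with hw
  have hfz : ∀ z, f z = z.re * w.re + z.im * w.im := fun z => by
    have : z = z.re • (1 : ℂ) + z.im • Complex.I := by
      simp [Complex.re_add_im]
    conv_lhs => rw [this, map_add, map_smul, map_smul]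
    simp [hw]
  have hw0 : w ≠ 0 := fun h0 => hf (by ext z; rw [hfz, h0]; simp)
  set v := w * Complex.exp (-(θ * Complex.I)) with hv
  have hv0 : v ≠ 0 := mul_ne_zero hw0 (Complex.exp_ne_zero _)
  have hwv : w = ‖v‖ * Complex.exp ((θ + v.arg : ℝ) * Complex.I) := by
    have h1 := Complex.norm_mul_exp_arg_mul_I v
    have h2 : w = v * Complex.exp (θ * Complex.I) := by
      rw [hv, mul_assoc, ← Complex.exp_add]; simp
    rw [h2]
    conv_lhs => rw [← h1]
    rw [mul_assoc, ← Complex.exp_add]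
    congr 2
    push_cast
    ring
  refine ⟨‖v‖, norm_pos_iff.2 hv0, v.arg, ⟨Complex.neg_pi_lt_arg v, Complex.arg_le_pi v⟩,
    fun z => ?_⟩
  have hre : w.re = ‖v‖ * cos (θ + v.arg) := by
    rw [hwv, Complex.re_ofReal_mul, Complex.exp_ofReal_mul_I_re]
  have him : w.im = ‖v‖ * sin (θ + v.arg) := by
    rw [hwv, Complex.im_ofReal_mul, Complex.exp_ofReal_mul_I_im]
  rw [hfz, hre, him]
  ring

variable {K : Set ℂ}

/-- If `K` left room around the disc throughout an arc of half-width `α > π / 3`, the disc could be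
shifted towards `θ` and deformed into a larger ellipse inside `K`. Since that ellipse does not fit,
some line separates one of its points from `K`, and its normal direction is the required `φ`. -/
theorem IsJohnPosition.exists_almost_contact (hJ : IsJohnPosition K) (hKc : IsClosed K)
    (hK : Convex ℝ K) {α : ℝ} (hα : π / 3 < α) (hα2 : α < π / 2) (θ : ℝ) {ε : ℝ} (hε : 0 < ε) :
    ∃ φ ∈ Set.Icc (θ - α) (θ + α), ∀ z ∈ K, z.re * cos φ + z.im * sin φ ≤ 1 + ε := by
  have hpi := pi_pos
  set x₀ := cos α with hx₀
  have hx₀pos : 0 < x₀ := cos_pos_of_mem_Ioo ⟨by linarith, hα2⟩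
  have hx₀half : x₀ < 1 / 2 := by
    rw [← cos_pi_div_three]
    exact cos_lt_cos_of_nonneg_of_le_pi (by positivity) (by linarith) hα
  -- This makes the support function of the ellipse at most `1` in all directions at angle at least
  -- `α` from `θ`. The condition `κ < 1`, needed for the area gain, is exactly `cos α < 1 / 2`.
  set κ := x₀ / (1 - x₀) with hκ
  have hκ0 : 0 ≤ κ := div_nonneg hx₀pos.le (by linarith)
  have hκ1 : κ < 1 := by rw [hκ, div_lt_one (by linarith)]; linarith
  obtain ⟨s, hs, hsκ, hsε⟩ : ∃ s > 0, s ≤ (1 - κ) / 4 ∧ s ≤ ε / 2 :=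
    ⟨min ((1 - κ) / 4) (ε / 2), lt_min (by linarith) (by linarith), min_le_left _ _,
      min_le_right _ _⟩
  set B := √(1 - 2 * s * κ) with hB
  have hB2 : B ^ 2 = 1 - 2 * s * κ := Real.sq_sqrt (by nlinarith)
  have hB0 : 0 ≤ B := Real.sqrt_nonneg _
  have hB1 : B ≤ 1 := by
    have : 0 ≤ s * κ := by positivity
    exact (sq_le_one_iff₀ hB0).1 (by linarith)
  have harea := one_lt_mul_of_small hs hκ0 hκ1 hsκ hB0 hB2
  let c : ℂ := ⟨s * cos θ, s * sin θ⟩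
  let p : ℂ := ⟨(1 + s) * cos θ, (1 + s) * sin θ⟩
  let q : ℂ := ⟨-(B * sin θ), B * cos θ⟩
  have hwedge : wedge p q = (1 + s) * B := by
    simp only [wedge, p, q]
    linear_combination (1 + s) * B * sin_sq_add_cos_sq θ
  have hnot : ¬ ellipse c p q ⊆ K := fun h => by
    have := hJ.abs_wedge_le_one c p q h
    rw [hwedge] at this
    linarith [le_abs_self ((1 + s) * B)]
  obtain ⟨P, ⟨x, y, hxy, rfl⟩, hPK⟩ := Set.not_subset.1 hnot
  obtain ⟨f, u, hfK, hfP⟩ := geometric_hahn_banach_closed_point hK hKc hPK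
  have h0K : (0 : ℂ) ∈ K := hJ.closedBall_subset (by simp)
  have hf0 : f ≠ 0 := by
    rintro rfl
    have := hfK 0 h0K
    simp at this hfP
    linarith
  obtain ⟨r, hr, ψ, hψ, hfz⟩ := exists_angle_of_clm hf0 θ
  have hP : (c + x • p + y • q).re * cos (θ + ψ) + (c + x • p + y • q).im * sin (θ + ψ) =
      (s + (1 + s) * x) * cos ψ + B * y * sin ψ := by
    have e1 : cos ψ = cos (θ + ψ) * cos θ + sin (θ + ψ) * sin θ := by
      rw [← cos_sub]; congr 1; ring
    have e2 : sin ψ = sin (θ + ψ) * cos θ - cos (θ + ψ) * sin θ := by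
      rw [← sin_sub]; congr 1; ring
    rw [e1, e2]
    simp [c, p, q]
    ring
  have hlt : ∀ z ∈ K, z.re * cos (θ + ψ) + z.im * sin (θ + ψ) <
      (s + (1 + s) * x) * cos ψ + B * y * sin ψ := fun z hz => by
    have h1 := (hfK z hz).trans hfP
    rw [hfz, hfz, hP] at h1
    exact lt_of_mul_lt_mul_left h1 hr.le
  -- Outside the arc the ellipse has support at most `1`, while `K` contains the unit disc, so no
  -- separating line can have its normal there.
  have hcos : cos α < cos ψ := by
    by_contra! hle
    have h1 := ellipse_support_le_one hs.le (by linarith) (by linarith) hle (cos_sq_add_sin_sq ψ)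
      hB2 hxy
    have h2 := hlt ⟨cos (θ + ψ), sin (θ + ψ)⟩ (hJ.closedBall_subset (by
      rw [mem_closedBall_zero_iff, ← sq_le_one_iff₀ (norm_nonneg _), Complex.sq_norm,
        Complex.normSq_mk]
      nlinarith [sin_sq_add_cos_sq (θ + ψ)]))
    nlinarith [sin_sq_add_cos_sq (θ + ψ)]
  have hψα : |ψ| < α := by
    by_contra! hle
    rw [← cos_abs ψ] at hcos
    exact hcos.not_ge (cos_le_cos_of_nonneg_of_le_pi (by linarith)
      (abs_le.2 ⟨hψ.1.le, hψ.2⟩) hle)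
  rw [abs_lt] at hψα
  refine ⟨θ + ψ, ⟨by linarith, by linarith⟩, fun z hz => (hlt z hz).le.trans ?_⟩
  have h1 : (1 + s) * cos ψ * x + B * sin ψ * y ≤ 1 + s := by
    refine add_mul_le_of_sq_le (by linarith) hxy ?_
    have h2 : (B * sin ψ) ^ 2 ≤ (1 + s) ^ 2 * sin ψ ^ 2 := by
      rw [mul_pow]
      exact mul_le_mul_of_nonneg_right (pow_le_pow_left₀ hB0 (by linarith) 2) (sq_nonneg _)
    nlinarith [sin_sq_add_cos_sq ψ]
  have h2 := mul_le_mul_of_nonneg_left (cos_le_one ψ) hs.le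
  linarith

theorem IsJohnPosition.exists_isContactAngle (hJ : IsJohnPosition K) (hKc : IsClosed K)
    (hK : Convex ℝ K) {α : ℝ} (hα : π / 3 < α) (hα2 : α < π / 2) (θ : ℝ) :
    ∃ φ ∈ Set.Icc (θ - α) (θ + α), IsContactAngle K φ := by
  choose φ hφ hφK using fun m : ℕ =>
    hJ.exists_almost_contact hKc hK hα hα2 θ (ε := 1 / ((m : ℝ) + 1)) (by positivity)
  obtain ⟨φ₀, hφ₀, σ, hσ, hlim⟩ := isCompact_Icc.tendsto_subseq hφ
  refine ⟨φ₀, hφ₀, fun z hz => ?_⟩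
  have h1 : Tendsto (fun m => z.re * cos (φ (σ m)) + z.im * sin (φ (σ m))) atTop
      (𝓝 (z.re * cos φ₀ + z.im * sin φ₀)) :=
    (((continuous_cos.tendsto φ₀).comp hlim).const_mul _).add
      (((continuous_sin.tendsto φ₀).comp hlim).const_mul _)
  have h2 : Tendsto (fun m => 1 + 1 / (((σ m : ℕ) : ℝ) + 1)) atTop (𝓝 (1 + 0)) :=
    (tendsto_one_div_add_atTop_nhds_zero_nat.comp hσ.tendsto_atTop).const_add 1
  rw [add_zero] at h2
  exact le_of_tendsto_of_tendsto' h1 h2 fun m => hφK (σ m) z hz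

end John

/-! ### Area of a planar convex set in John position -/

section JohnArea

open Real Filter Topology

variable {K : Set ℂ}

theorem setLIntegral_Ioc_le_of_hasDerivAt {G : ℝ → ENNReal} {F F' : ℝ → ℝ} {a b : ℝ} (hab : a ≤ b)
    (hF : ∀ x ∈ Set.Icc a b, HasDerivAt F (F' x) x) (hF' : ContinuousOn F' (Set.Icc a b))
    (h0 : ∀ x ∈ Set.Icc a b, 0 ≤ F' x) (hG : ∀ x ∈ Set.Ioc a b, G x ≤ ENNReal.ofReal (F' x)) :
    ∫⁻ x in Set.Ioc a b, G x ≤ ENNReal.ofReal (F b - F a) := by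
  have hI : IntervalIntegrable F' volume a b :=
    ContinuousOn.intervalIntegrable (by rwa [Set.uIcc_of_le hab])
  rw [← intervalIntegral.integral_eq_sub_of_hasDerivAt (by rwa [Set.uIcc_of_le hab]) hI,
    intervalIntegral.integral_of_le hab, ofReal_integral_eq_lintegral_ofReal
      ((intervalIntegrable_iff_integrableOn_Ioc_of_le hab).1 hI)
      ((ae_restrict_iff' measurableSet_Ioc).2
        (Eventually.of_forall fun x hx => h0 x (Set.Ioc_subset_Icc_self hx)))]
  exact setLIntegral_mono' measurableSet_Ioc hG

/-- The area of `K` per unit angle in direction `θ`. -/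
noncomputable def radialArea (K : Set ℂ) (θ : ℝ) : ENNReal :=
  ∫⁻ r in Set.Ioi 0, ENNReal.ofReal r * K.indicator 1 (r * (cos θ + sin θ * Complex.I))

theorem volume_eq_lintegral_radialArea (hK : MeasurableSet K) :
    volume K = ∫⁻ θ in Set.Ioo (-π) π, radialArea K θ := by
  rw [← lintegral_indicator_one hK, ← Complex.lintegral_comp_polarCoord_symm]
  change ∫⁻ p in Set.Ioi (0 : ℝ) ×ˢ Set.Ioo (-π) π, _ = _
  rw [Measure.volume_eq_prod, setLIntegral_prod_symm]
  · simp [radialArea]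
  · refine Measurable.aemeasurable ?_
    simp only [Complex.polarCoord_symm_apply, smul_eq_mul]
    refine Measurable.mul (by fun_prop) ((measurable_one.indicator hK).comp (by fun_prop))

theorem radialArea_le {φ θ : ℝ} (hφ : IsContactAngle K φ) (hcos : 0 < cos (θ - φ)) :
    radialArea K θ ≤ ENNReal.ofReal (1 / cos (θ - φ) ^ 2 / 2) := by
  have hρ : 0 < 1 / cos (θ - φ) := by positivity
  have h1 : radialArea K θ ≤ ∫⁻ r in Set.Ioc 0 (1 / cos (θ - φ)), ENNReal.ofReal r := by
    rw [radialArea, ← lintegral_indicator measurableSet_Ioi,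
      ← lintegral_indicator measurableSet_Ioc]
    refine lintegral_mono fun r => ?_
    by_cases hr : 0 < r
    · rw [Set.indicator_of_mem (Set.mem_Ioi.2 hr)]
      by_cases hrK : (r * (cos θ + sin θ * Complex.I) : ℂ) ∈ K
      · have h2 := hφ _ hrK
        have h3 : r * cos (θ - φ) ≤ 1 := by
          rw [cos_sub]
          simp only [Complex.add_re, Complex.add_im, Complex.ofReal_re,
            Complex.ofReal_im, Complex.mul_re, Complex.mul_im, Complex.I_re, Complex.I_im] at h2
          linarith
        have h4 : r ∈ Set.Ioc 0 (1 / cos (θ - φ)) := ⟨hr, (le_div_iff₀ hcos).2 h3⟩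
        rw [Set.indicator_of_mem hrK, Set.indicator_of_mem h4]
        simp
      · rw [Set.indicator_of_notMem hrK]
        simp
    · rw [Set.indicator_of_notMem (by simpa using hr)]
      exact zero_le
  refine h1.trans ((setLIntegral_Ioc_le_of_hasDerivAt (F := fun r => r ^ 2 / 2) (F' := fun r => r)
    hρ.le (fun r _ => ?_) continuousOn_id (fun r hr => hr.1) fun r _ => le_rfl).trans
      (le_of_eq ?_))
  · have := (hasDerivAt_pow 2 r).div_const 2
    simpa using this
  · congr 1
    field_simp
    simp

/-- The sector is cut at the bisecting angle, and each half lies below the nearer of the two tangent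
lines. Each half is thus contained in a right triangle of area `tan ((b - a) / 2) / 2`. -/
theorem setLIntegral_radialArea_gap_le {a b : ℝ} (ha : IsContactAngle K a)
    (hb : IsContactAngle K b) (hab : a ≤ b) (hgap : b - a < π) :
    ∫⁻ θ in Set.Ioc a b, radialArea K θ ≤ ENNReal.ofReal (tan ((b - a) / 2)) := by
  set m := (a + b) / 2 with hm
  have hpi := pi_pos
  have hderiv : ∀ c x, 0 < cos (x - c) →
      HasDerivAt (fun θ => tan (θ - c) / 2) (1 / cos (x - c) ^ 2 / 2) x := fun c x hx => by
    have := (HasDerivAt.comp x (hasDerivAt_tan hx.ne')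
      ((hasDerivAt_id x).sub_const c)).div_const 2
    simpa using this
  have hcont : ∀ c (s : Set ℝ), (∀ x ∈ s, 0 < cos (x - c)) →
      ContinuousOn (fun x => 1 / cos (x - c) ^ 2 / 2) s := fun c s hs => by
    refine ContinuousOn.div_const (ContinuousOn.div (by fun_prop) (by fun_prop) fun x hx => ?_) _
    exact (pow_pos (hs x hx) 2).ne'
  have hca : ∀ x ∈ Set.Icc a m, 0 < cos (x - a) := fun x hx =>
    cos_pos_of_mem_Ioo ⟨by linarith [hx.1], by linarith [hx.2]⟩
  have hcb : ∀ x ∈ Set.Icc m b, 0 < cos (x - b) := fun x hx =>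
    cos_pos_of_mem_Ioo ⟨by linarith [hx.1], by linarith [hx.2]⟩
  have h1 := setLIntegral_Ioc_le_of_hasDerivAt (G := radialArea K) (by linarith : a ≤ m)
    (fun x hx => hderiv a x (hca x hx)) (hcont a _ hca) (fun x _ => by positivity)
    (fun x hx => radialArea_le ha (hca x (Set.Ioc_subset_Icc_self hx)))
  have h2 := setLIntegral_Ioc_le_of_hasDerivAt (G := radialArea K) (by linarith : m ≤ b)
    (fun x hx => hderiv b x (hcb x hx)) (hcont b _ hcb) (fun x _ => by positivity)
    (fun x hx => radialArea_le hb (hcb x (Set.Ioc_subset_Icc_self hx)))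
  have e1 : m - a = (b - a) / 2 := by rw [hm]; ring
  have e2 : m - b = -((b - a) / 2) := by rw [hm]; ring
  have ht : 0 ≤ tan ((b - a) / 2) := tan_nonneg_of_nonneg_of_le_pi_div_two (by linarith)
    (by linarith)
  rw [e1, sub_self, tan_zero, zero_div, sub_zero] at h1
  rw [e2, sub_self, tan_zero, tan_neg, zero_div, zero_sub, neg_div, neg_neg] at h2
  rw [← Set.Ioc_union_Ioc_eq_Ioc (by linarith : a ≤ m) (by linarith : m ≤ b),
    lintegral_union measurableSet_Ioc (Set.Ioc_disjoint_Ioc_of_le le_rfl)]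
  refine (add_le_add h1 h2).trans ?_
  rw [← ENNReal.ofReal_add (by positivity) (by positivity), add_halves]

theorem convexOn_tan : ConvexOn ℝ (Set.Ico 0 (π / 2)) tan := by
  have hcos : ∀ x ∈ Set.Ico 0 (π / 2), 0 < cos x := fun x hx =>
    cos_pos_of_mem_Ioo ⟨by linarith [hx.1, pi_pos], hx.2⟩
  have hint : interior (Set.Ico 0 (π / 2)) ⊆ Set.Ico 0 (π / 2) := interior_subset
  refine MonotoneOn.convexOn_of_deriv (convex_Ico _ _)
    (fun x hx => (hasDerivAt_tan (hcos x hx).ne').continuousAt.continuousWithinAt)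
    (fun x hx => (hasDerivAt_tan (hcos x (hint hx)).ne').differentiableAt.differentiableWithinAt)
    fun x hx y hy hxy => ?_
  have hx' := hcos x (hint hx)
  have hy' := hcos y (hint hy)
  rw [(hasDerivAt_tan hx'.ne').deriv, (hasDerivAt_tan hy'.ne').deriv]
  refine one_div_le_one_div_of_le (by positivity) (pow_le_pow_left₀ hy'.le ?_ 2)
  exact cos_le_cos_of_nonneg_of_le_pi (hint hx).1 (by linarith [(hint hy).2, pi_pos]) hxy

theorem tan_le_mul_of_le {x α : ℝ} (hx : 0 ≤ x) (hxα : x ≤ α) (hα0 : 0 < α) (hα : α < π / 2) :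
    tan x ≤ tan α / α * x := by
  have h0 : (0 : ℝ) ∈ Set.Ico 0 (π / 2) := ⟨le_rfl, by positivity⟩
  have h1 : α ∈ Set.Ico 0 (π / 2) := ⟨hα0.le, hα⟩
  have h2 : 0 ≤ 1 - x / α := sub_nonneg.2 ((div_le_one hα0).2 hxα)
  have h3 : 0 ≤ x / α := by positivity
  have h := convexOn_tan.2 h0 h1 h2 h3 (by ring)
  simp only [smul_eq_mul, mul_zero, zero_add, tan_zero, div_mul_cancel₀ x hα0.ne'] at h
  calc tan x ≤ x / α * tan α := h
    _ = _ := by ring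

/-- Between contact angles at most `2 * α` apart, convexity of `tan` bounds the area linearly in the
gap. Chaining contact angles makes these bounds additive; the margin `α - α'` guarantees progress at
each step. -/
theorem setLIntegral_radialArea_le {α α' : ℝ} (hα' : 0 < α') (hαα' : α' < α) (hα : α < π / 2)
    (hcontact : ∀ θ, ∃ φ ∈ Set.Icc (θ - α') (θ + α'), IsContactAngle K φ) (N : ℕ) :
    ∀ a b, IsContactAngle K a → IsContactAngle K b → a ≤ b → b - a ≤ N * (α - α') →
      ∫⁻ θ in Set.Ioc a b, radialArea K θ ≤ ENNReal.ofReal (tan α / (2 * α) * (b - a)) := by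
  have hα0 : 0 < α := hα'.trans hαα'
  have hpi := pi_pos
  have hgap : ∀ a b, IsContactAngle K a → IsContactAngle K b → a ≤ b → b - a ≤ 2 * α →
      ∫⁻ θ in Set.Ioc a b, radialArea K θ ≤ ENNReal.ofReal (tan α / (2 * α) * (b - a)) :=
    fun a b ha hb hab hba => by
      refine (setLIntegral_radialArea_gap_le ha hb hab (by linarith)).trans
        (ENNReal.ofReal_le_ofReal ?_)
      refine (tan_le_mul_of_le (by linarith) (by linarith) hα0 hα).trans (le_of_eq ?_)
      field_simp
  induction N with
  | zero =>
    intro a b ha hb hab h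
    exact hgap a b ha hb hab (by simp at h; linarith)
  | succ N ih =>
    intro a b ha hb hab h
    rcases le_or_gt (b - a) (2 * α) with hle | hlt
    · exact hgap a b ha hb hab hle
    -- The new contact angle lies beyond `a + (α - α')` and before `a + 2 * α`.
    · obtain ⟨m, ⟨hm1, hm2⟩, hm⟩ := hcontact (a + α)
      have ham : a ≤ m := by linarith
      have hmb : m ≤ b := by linarith
      have ht : 0 ≤ tan α / (2 * α) :=
        div_nonneg (tan_nonneg_of_nonneg_of_le_pi_div_two hα0.le hα.le) (by linarith)
      rw [← Set.Ioc_union_Ioc_eq_Ioc ham hmb,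
        lintegral_union measurableSet_Ioc (Set.Ioc_disjoint_Ioc_of_le le_rfl)]
      refine (add_le_add (hgap a m ha hm ham (by linarith)) (ih m b hm hb hmb ?_)).trans ?_
      · push_cast at h
        linarith
      · rw [← ENNReal.ofReal_add (mul_nonneg ht (by linarith)) (mul_nonneg ht (by linarith))]
        refine ENNReal.ofReal_le_ofReal (le_of_eq ?_)
        ring

theorem radialArea_periodic (K : Set ℂ) : Function.Periodic (radialArea K) (2 * π) := fun θ => by
  simp only [radialArea, cos_add_two_pi, sin_add_two_pi]

theorem IsContactAngle.add_two_pi {φ : ℝ} (h : IsContactAngle K φ) :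
    IsContactAngle K (φ + 2 * π) := fun z hz => by
  rw [cos_add_two_pi, sin_add_two_pi]
  exact h z hz

theorem setLIntegral_periodic_Ioc {G : ℝ → ENNReal} {T : ℝ} (hT : 0 < T)
    (hG : Function.Periodic G T) (a b : ℝ) :
    ∫⁻ x in Set.Ioc a (a + T), G x = ∫⁻ x in Set.Ioc b (b + T), G x := by
  refine (isAddFundamentalDomain_Ioc hT a volume).setLIntegral_eq
    (isAddFundamentalDomain_Ioc hT b volume) G ?_
  rintro ⟨g, hg⟩ x
  obtain ⟨m, rfl⟩ := AddSubgroup.mem_zmultiples_iff.1 hg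
  change G (m • T + x) = G x
  rw [add_comm]
  exact hG.zsmul m x

theorem IsJohnPosition.volume_le_of_angle (hJ : IsJohnPosition K) (hKc : IsClosed K)
    (hK : Convex ℝ K) {α : ℝ} (hα : π / 3 < α) (hα2 : α < π / 2) :
    volume K ≤ ENNReal.ofReal (π * (tan α / α)) := by
  obtain ⟨α', h1, h2⟩ := exists_between hα
  have hpi := pi_pos
  have hcontact := hJ.exists_isContactAngle hKc hK h1 (h2.trans hα2)
  obtain ⟨φ, -, hφ⟩ := hcontact 0
  obtain ⟨N, hN⟩ := exists_nat_ge (2 * π / (α - α'))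
  rw [div_le_iff₀ (by linarith)] at hN
  have h := setLIntegral_radialArea_le (by linarith) h2 hα2 hcontact N φ (φ + 2 * π) hφ
    hφ.add_two_pi (by linarith) (by linarith)
  rw [setLIntegral_periodic_Ioc (by positivity) (radialArea_periodic K) φ (-π)] at h
  rw [volume_eq_lintegral_radialArea hKc.measurableSet]
  refine (lintegral_mono_set (Set.Ioo_subset_Ioc_self.trans
    (Set.Ioc_subset_Ioc_right (by linarith)))).trans (h.trans (le_of_eq ?_))
  congr 1
  field_simp
  ring

/-- The limit `α ↓ π / 3` of the previous bound. -/
theorem IsJohnPosition.volume_le (hJ : IsJohnPosition K) (hKc : IsClosed K) (hK : Convex ℝ K) :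
    volume K ≤ ENNReal.ofReal (3 * √3) := by
  have hpi := pi_pos
  have hcos : cos (π / 3) ≠ 0 := by rw [cos_pi_div_three]; norm_num
  have hc : ContinuousAt (fun α => ENNReal.ofReal (π * (tan α / α))) (π / 3) :=
    ENNReal.continuous_ofReal.continuousAt.comp
      (((hasDerivAt_tan hcos).continuousAt.div continuousAt_id
        (by change π / 3 ≠ 0; positivity)).const_mul π)
  have hval : π * (tan (π / 3) / (π / 3)) = 3 * √3 := by
    rw [tan_pi_div_three]
    field_simp
  have hlim : Tendsto (fun α => ENNReal.ofReal (π * (tan α / α))) (𝓝[>] (π / 3))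
      (𝓝 (ENNReal.ofReal (3 * √3))) := by
    rw [← hval]
    exact hc.tendsto.mono_left nhdsWithin_le_nhds
  refine ge_of_tendsto hlim ?_
  filter_upwards [Ioo_mem_nhdsGT (by linarith : π / 3 < π / 2)] with α hα
  exact hJ.volume_le_of_angle hKc hK hα.1 hα.2

end JohnArea

/-! ### Ellipses of maximal area -/

section MaximalEllipse

open Filter Topology

variable {K : Set ℂ}

/-- The linear map that sends the standard basis `1, I` of the plane to `p, q`. -/
noncomputable def basisMap (p q : ℂ) : ℂ →ₗ[ℝ] ℂ :=
  Complex.reLm.smulRight p + Complex.imLm.smulRight q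

theorem basisMap_apply (p q z : ℂ) : basisMap p q z = z.re • p + z.im • q := rfl

theorem det_basisMap (p q : ℂ) : LinearMap.det (basisMap p q) = wedge p q := by
  rw [← LinearMap.det_toMatrix Complex.basisOneI, Matrix.det_fin_two]
  simp [LinearMap.toMatrix_apply, basisMap_apply, wedge]
  ring

theorem mem_closedBall_iff_sq_le {z : ℂ} :
    z ∈ Metric.closedBall 0 1 ↔ z.re ^ 2 + z.im ^ 2 ≤ 1 := by
  rw [mem_closedBall_zero_iff, ← sq_le_one_iff₀ (norm_nonneg _), Complex.sq_norm,
    Complex.normSq_apply, sq, sq]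

theorem ellipse_eq_image (c p q : ℂ) :
    ellipse c p q = (fun z => c + z) '' (basisMap p q '' Metric.closedBall 0 1) := by
  ext z
  simp only [Set.mem_image, exists_exists_and_eq_and, mem_closedBall_iff_sq_le]
  constructor
  · rintro ⟨x, y, h, rfl⟩
    exact ⟨⟨x, y⟩, h, by simp only [basisMap_apply]; ring⟩
  · rintro ⟨w, h, rfl⟩
    exact ⟨w.re, w.im, h, by simp only [basisMap_apply]; ring⟩

theorem measureReal_ellipse (c p q : ℂ) :
    volume.real (ellipse c p q) = |wedge p q| * Real.pi := by
  rw [ellipse_eq_image, Set.image_add_left, Measure.real, measure_preimage_add,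
    Measure.addHaar_image_linearMap, det_basisMap, Complex.volume_closedBall]
  simp

/-- Degenerate ellipses are admitted, so the parameter set is compact. A small disc in the interior
shows that the maximum is not degenerate. -/
theorem exists_maximal_ellipse (hK : IsCompact K) (hint : (interior K).Nonempty) :
    ∃ c p q, ellipse c p q ⊆ K ∧ wedge p q ≠ 0 ∧
      ∀ c' p' q', ellipse c' p' q' ⊆ K → |wedge p' q'| ≤ |wedge p q| := by
  set S : Set (ℂ × ℂ × ℂ) := {t | ellipse t.1 t.2.1 t.2.2 ⊆ K} with hS
  have hclosed : IsClosed S := by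
    have : S = ⋂ x : ℝ, ⋂ y : ℝ, ⋂ _ : x ^ 2 + y ^ 2 ≤ 1,
        (fun t : ℂ × ℂ × ℂ => t.1 + x • t.2.1 + y • t.2.2) ⁻¹' K := by
      ext t
      simp only [hS, Set.mem_iInter, Set.mem_preimage]
      exact ⟨fun h x y hxy => h ⟨x, y, hxy, rfl⟩, fun h z ⟨x, y, hxy, hz⟩ => hz ▸ h x y hxy⟩
    rw [this]
    exact isClosed_iInter fun x => isClosed_iInter fun y => isClosed_iInter fun _ =>
      hK.isClosed.preimage (by fun_prop)
  obtain ⟨ρ, hρ⟩ := hK.isBounded.subset_closedBall 0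
  have hbdd : S ⊆ Metric.closedBall 0 ρ ×ˢ Metric.closedBall 0 (ρ + ρ) ×ˢ
      Metric.closedBall 0 (ρ + ρ) := by
    rintro ⟨c, p, q⟩ h
    have h1 : ‖c‖ ≤ ρ := by simpa using hρ (h ⟨0, 0, by norm_num, by simp⟩)
    have h2 : ‖c + p‖ ≤ ρ := by
      simpa using hρ (h ⟨1, 0, by norm_num, rfl⟩)
    have h3 : ‖c + q‖ ≤ ρ := by
      simpa using hρ (h ⟨0, 1, by norm_num, rfl⟩)
    simp only [Set.mem_prod, mem_closedBall_zero_iff]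
    refine ⟨h1, ?_, ?_⟩
    · rw [← add_sub_cancel_left c p]
      exact (norm_sub_le _ _).trans (add_le_add h2 h1)
    · rw [← add_sub_cancel_left c q]
      exact (norm_sub_le _ _).trans (add_le_add h3 h1)
  have hcompact : IsCompact S := ((isCompact_closedBall _ _).prod
    ((isCompact_closedBall _ _).prod (isCompact_closedBall _ _))).of_isClosed_subset hclosed hbdd
  obtain ⟨z₀, hz₀⟩ := hint
  obtain ⟨r, hr, hball⟩ := Metric.nhds_basis_closedBall.mem_iff.1 (mem_interior_iff_mem_nhds.1 hz₀)
  have hmem : ((z₀, (r : ℂ), (r : ℂ) * Complex.I) : ℂ × ℂ × ℂ) ∈ S := by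
    rintro z ⟨x, y, hxy, rfl⟩
    refine hball ?_
    have h1 : z₀ + x • (r : ℂ) + y • ((r : ℂ) * Complex.I) - z₀ = r * (⟨x, y⟩ : ℂ) := by
      apply Complex.ext <;> simp <;> ring
    rw [mem_closedBall_iff_norm, h1, norm_mul, Complex.norm_real, Real.norm_of_nonneg hr.le]
    have h2 : (⟨x, y⟩ : ℂ) ∈ Metric.closedBall (0 : ℂ) 1 := mem_closedBall_iff_sq_le.2 hxy
    rw [mem_closedBall_zero_iff] at h2
    nlinarith
  have hcont : Continuous fun t : ℂ × ℂ × ℂ => |wedge t.2.1 t.2.2| := by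
    unfold wedge
    fun_prop
  obtain ⟨⟨c, p, q⟩, ht, hmax⟩ := hcompact.exists_isMaxOn ⟨_, hmem⟩ hcont.continuousOn
  refine ⟨c, p, q, ht, ?_, fun c' p' q' h' => hmax (a := (c', p', q')) h'⟩
  intro h0
  have h1 := hmax hmem
  simp only [h0, abs_zero, Set.mem_ofPred_eq] at h1
  have h2 : wedge (r : ℂ) ((r : ℂ) * Complex.I) = r * r := by simp [wedge]
  rw [h2, abs_of_pos (by positivity)] at h1
  nlinarith

theorem wedge_basisMap (p q p' q' : ℂ) :
    wedge (basisMap p q p') (basisMap p q q') = wedge p q * wedge p' q' := by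
  simp only [wedge, basisMap_apply, Complex.add_re, Complex.add_im, Complex.smul_re,
    Complex.smul_im, smul_eq_mul]
  ring

/-- An ellipse of maximal area in a planar convex body fills at least the proportion
`π / (3√3)` of it. -/
theorem exists_ellipse_measureReal_le (hK : IsCompact K) (hconv : Convex ℝ K)
    (hint : (interior K).Nonempty) :
    ∃ c p q, ellipse c p q ⊆ K ∧ wedge p q ≠ 0 ∧
      volume.real K ≤ |wedge p q| * (3 * √3) := by
  obtain ⟨c, p, q, hsub, hw, hmax⟩ := exists_maximal_ellipse hK hint
  refine ⟨c, p, q, hsub, hw, ?_⟩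
  -- The affine map taking the unit disc to the maximal ellipse pulls `K` back to John position,
  -- since it scales all ellipse areas by the same factor.
  set K' : Set ℂ := {z | c + basisMap p q z ∈ K} with hK'
  have hdet : LinearMap.det (basisMap p q) ≠ 0 := by rwa [det_basisMap]
  have hcontinuous : Continuous (basisMap p q) := (basisMap p q).continuous_of_finiteDimensional
  have hclosed : IsClosed K' := hK.isClosed.preimage (by fun_prop)
  have hconv' : Convex ℝ K' :=
    (hconv.translate_preimage_right c).linear_preimage (basisMap p q)
  have hJ : IsJohnPosition K' := by
    refine ⟨fun z hz => ?_, fun c' p' q' h' => ?_⟩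
    · refine hsub ⟨z.re, z.im, mem_closedBall_iff_sq_le.1 hz, ?_⟩
      rw [basisMap_apply, add_assoc]
    · have h1 := hmax (c + basisMap p q c') (basisMap p q p') (basisMap p q q') ?_
      · rw [wedge_basisMap, abs_mul] at h1
        exact le_of_mul_le_mul_left (by linarith) (abs_pos.2 hw)
      · rintro z ⟨x, y, hxy, rfl⟩
        have h2 := h' ⟨x, y, hxy, rfl⟩
        simp only [hK', Set.mem_ofPred_eq, map_add, map_smul] at h2
        simpa [add_assoc] using h2
  have hvol : volume K' = ENNReal.ofReal |(wedge p q)⁻¹| * volume K := by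
    have : K' = basisMap p q ⁻¹' ((fun z => c + z) ⁻¹' K) := rfl
    rw [this, Measure.addHaar_preimage_linearMap _ hdet, det_basisMap, measure_preimage_add]
  have h1 := hJ.volume_le hclosed hconv'
  rw [hvol] at h1
  have h2 := ENNReal.toReal_mono ENNReal.ofReal_ne_top h1
  rw [ENNReal.toReal_mul, ENNReal.toReal_ofReal (abs_nonneg _),
    ENNReal.toReal_ofReal (by positivity), abs_inv, inv_mul_le_iff₀ (abs_pos.2 hw)] at h2
  exact h2

/-- Rotating the parameter circle moves through pairs of conjugate half-diameters. A quarter turn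
negates their inner product, so it vanishes somewhere in between. -/
theorem exists_orthogonal_axes (c p q : ℂ) :
    ∃ p' q', ellipse c p' q' ⊆ ellipse c p q ∧ wedge p' q' = wedge p q ∧
      p'.re * q'.re + p'.im * q'.im = 0 := by
  let P : ℝ → ℂ := fun t => Real.cos t • p + Real.sin t • q
  let Q : ℝ → ℂ := fun t => -Real.sin t • p + Real.cos t • q
  let f : ℝ → ℝ := fun t => (P t).re * (Q t).re + (P t).im * (Q t).im
  have hf : Continuous f := by
    simp only [f, P, Q]
    fun_prop
  have h0 : f (Real.pi / 2) = - f 0 := by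
    simp [f, P, Q]
    ring
  obtain ⟨t, ht⟩ : (0 : ℝ) ∈ Set.range f := by
    rcases le_total (f 0) 0 with h | h
    · exact mem_range_of_exists_le_of_exists_ge hf ⟨0, h⟩ ⟨Real.pi / 2, by linarith⟩
    · exact mem_range_of_exists_le_of_exists_ge hf ⟨Real.pi / 2, by linarith⟩ ⟨0, h⟩
  refine ⟨P t, Q t, ?_, ?_, ht⟩
  · rintro z ⟨x, y, hxy, rfl⟩
    refine ⟨x * Real.cos t - y * Real.sin t, x * Real.sin t + y * Real.cos t, ?_, ?_⟩
    · nlinarith [Real.sin_sq_add_cos_sq t]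
    · simp only [P, Q]
      module
  · simp only [wedge, P, Q, Complex.add_re, Complex.add_im, Complex.smul_re, Complex.smul_im,
      smul_eq_mul]
    linear_combination (p.re * q.im - p.im * q.re) * Real.sin_sq_add_cos_sq t

theorem reflection_isSymmetric {V : Type*} [NormedAddCommGroup V] [InnerProductSpace ℝ V]
    (S : Submodule ℝ V) [S.HasOrthogonalProjection] :
    (S.reflection.toLinearEquiv : V →ₗ[ℝ] V).IsSymmetric := fun x y => by
  have := S.reflection.inner_map_map x (S.reflection y)
  rw [Submodule.reflection_reflection] at this
  exact this

/-- The reflection in the axis through `c` along `p` maps the maximal ellipse to itself, so the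
ellipse lies in the overlap. -/
theorem pi_div_le_kSymmetry (K : ConvexBody (EuclideanSpace ℝ (Fin 2)))
    (hK : (interior (K : Set (EuclideanSpace ℝ (Fin 2)))).Nonempty) :
    Real.pi / (3 * √3) ≤ kSymmetry 1 (K : Set (EuclideanSpace ℝ (Fin 2))) := by
  let J : ℂ ≃ₗᵢ[ℝ] EuclideanSpace ℝ (Fin 2) := Complex.orthonormalBasisOneI.repr
  set X := (K : Set (EuclideanSpace ℝ (Fin 2))) with hX
  have hXc : IsCompact X := K.isCompact
  have hXpos : 0 < volume.real X :=
    ENNReal.toReal_pos (Measure.measure_pos_of_nonempty_interior _ hK).ne' hXc.measure_ne_top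
  have hvol : ∀ Y, volume.real (J ⁻¹' Y) = volume.real Y := fun Y => by
    rw [Measure.real, Measure.real,
      J.measurePreserving.measure_preimage_emb J.toMeasurableEquiv.measurableEmbedding]
  obtain ⟨c, p₀, q₀, hsub₀, hw₀, hle₀⟩ := exists_ellipse_measureReal_le (K := J ⁻¹' X)
    (J.toHomeomorph.isCompact_preimage.2 hXc)
    (K.convex.linear_preimage J.toLinearEquiv.toLinearMap) (by
      have := J.toHomeomorph.preimage_interior X
      change (interior (J.toHomeomorph ⁻¹' X)).Nonempty
      rw [← this]
      obtain ⟨z, hz⟩ := hK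
      exact ⟨J.symm z, by simpa using hz⟩)
  obtain ⟨p, q, hsub, hw, horth⟩ := exists_orthogonal_axes c p₀ q₀
  rw [← hw] at hw₀ hle₀
  replace hsub := hsub.trans hsub₀
  rw [hvol] at hle₀
  have hp : p ≠ 0 := by
    rintro rfl
    simp [wedge] at hw₀
  have hJp : J p ≠ 0 := by simpa using hp
  let S : Submodule ℝ (EuclideanSpace ℝ (Fin 2)) := Submodule.span ℝ {J p}
  let A : EuclideanSpace ℝ (Fin 2) →ₗ[ℝ] EuclideanSpace ℝ (Fin 2) :=
    (S.reflection.toLinearEquiv : _ →ₗ[ℝ] _)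
  have hAx : ∀ x, A x = S.reflection x := fun x => rfl
  have hAp : A (J p) = J p :=
    S.reflection_mem_subspace_eq_self (Submodule.mem_span_singleton_self _)
  have hAq : A (J q) = - J q := by
    refine Submodule.reflection_mem_subspace_orthogonalComplement_eq_neg ?_
    rw [Submodule.mem_orthogonal_singleton_iff_inner_right, J.inner_map_map, Complex.inner]
    simp
    linarith
  have htr : LinearMap.trace ℝ _ A = 2 * (1 : ℕ) - (2 : ℕ) := by
    rw [Submodule.trace_reflection, finrank_span_singleton hJp, finrank_euclideanSpace_fin]
  have hinv : ∀ x, A (A x) = x := fun x => by simp [hAx]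
  have h1 := measureReal_inter_le_kSymmetry_mul (k := 1) hXc.measure_ne_top hXpos hinv
    (reflection_isSymmetric S) htr (v := J c - A (J c)) (by rw [map_sub, hinv]; abel)
  have h2 : ellipse c p q ⊆ J ⁻¹' (X ∩ {y | A y + (J c - A (J c)) ∈ X}) := by
    intro z hz
    refine ⟨hsub hz, ?_⟩
    obtain ⟨x, y, hxy, rfl⟩ := hz
    have h3 : c + x • p + (-y) • q ∈ J ⁻¹' X := hsub ⟨x, -y, by simpa using hxy, rfl⟩
    have h4 : A (J (c + x • p + y • q)) + (J c - A (J c)) = J (c + x • p + (-y) • q) := by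
      simp only [map_add, map_smul, hAp, hAq]
      module
    rw [Set.mem_ofPred_eq, h4]
    exact h3
  have h3 : |wedge p q| * Real.pi ≤ kSymmetry 1 X * volume.real X := by
    rw [← measureReal_ellipse c]
    refine le_trans ?_ h1
    rw [← hvol]
    refine measureReal_mono h2 ?_
    rw [J.measurePreserving.measure_preimage_emb J.toMeasurableEquiv.measurableEmbedding]
    exact measure_ne_top_of_subset Set.inter_subset_left hXc.measure_ne_top
  have hwpos : 0 < |wedge p q| := abs_pos.2 hw₀
  rw [div_le_iff₀ (by positivity)]
  have h4 := mul_le_mul_of_nonneg_left hle₀ (kSymmetry_nonneg (k := 1) X)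
  have h5 : |wedge p q| * Real.pi ≤ |wedge p q| * (kSymmetry 1 X * (3 * √3)) := by linarith
  exact le_of_mul_le_mul_left h5 hwpos

theorem coneConst_eq_inv_pow (n : ℕ) :
    coneConst n = ((2 - (2 : ℝ) ^ (-(1 / (n : ℝ)))) ^ n)⁻¹ := by
  rw [coneConst, zpow_neg, zpow_natCast]

theorem coneConst_two_le : coneConst 2 ≤ Real.pi / (3 * √3) := by
  rw [coneConst_eq_inv_pow]
  set w := (2 : ℝ) ^ (-(1 / ((2 : ℕ) : ℝ))) with hw
  have hw0 : 0 < w := Real.rpow_pos_of_pos two_pos _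
  have hw2 : w ^ 2 = 1 / 2 := two_rpow_neg_inv_pow two_ne_zero
  have hwlt : w < 0.7072 := by nlinarith
  have h3 : √3 < 1.7321 := by
    rw [Real.sqrt_lt' (by norm_num)]
    norm_num
  have hpi := Real.pi_gt_d2
  have h30 : 0 < √3 := by positivity
  have h4 : (2 - w) ^ 2 = 4.5 - 4 * w := by linear_combination hw2
  rw [h4, inv_eq_one_div, div_le_div_iff₀ (by linarith) (by positivity)]
  nlinarith

/-- With `w = 2 ^ (-1 / 2)`, the numbers `2 - w` and `w` have mean `1`. Concavity of `x ^ (2 / n)`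
gives `(2 - w) ^ (2 / n) + 2 ^ (-1 / n) ≤ 2`, and raising to the power `n` compares the
denominators. -/
theorem coneConst_le_coneConst_two {n : ℕ} (hn : 2 ≤ n) : coneConst n ≤ coneConst 2 := by
  have hn0 : n ≠ 0 := by omega
  have hnR : (2 : ℝ) ≤ n := by exact_mod_cast hn
  rw [coneConst_eq_inv_pow, coneConst_eq_inv_pow]
  set w := (2 : ℝ) ^ (-(1 / ((2 : ℕ) : ℝ))) with hw
  have hw0 : 0 < w := Real.rpow_pos_of_pos two_pos _
  have hw1 : w < 1 := two_rpow_neg_inv_lt_one two_ne_zero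
  have hwn : w ^ (2 / (n : ℝ)) = (2 : ℝ) ^ (-(1 / (n : ℝ))) := by
    rw [hw, ← Real.rpow_mul zero_le_two]
    congr 1
    push_cast
    field_simp
  have hconc := (Real.concaveOn_rpow (p := 2 / (n : ℝ)) (by positivity)
    ((div_le_one (by linarith)).2 hnR)).2 (Set.mem_Ici.2 (by linarith : 0 ≤ 2 - w))
    (Set.mem_Ici.2 hw0.le) one_half_pos.le one_half_pos.le (add_halves 1)
  simp only [smul_eq_mul] at hconc
  have e : 1 / 2 * (2 - w) + 1 / 2 * w = 1 := by ring
  rw [e, Real.one_rpow, hwn] at hconc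
  refine inv_anti₀ (pow_pos (by linarith) _) ?_
  have h1 : (2 - w) ^ (2 / (n : ℝ)) ≤ 2 - (2 : ℝ) ^ (-(1 / (n : ℝ))) := by linarith
  have h2 : ((2 - w) ^ (2 / (n : ℝ))) ^ n = (2 - w) ^ 2 := by
    rw [← Real.rpow_natCast, ← Real.rpow_mul (by linarith), div_mul_cancel₀ _ (by positivity),
      Real.rpow_two]
  rw [← h2]
  exact pow_le_pow_left₀ (Real.rpow_nonneg (by linarith) _) h1 n

theorem coneConst_le_sigma_two_one {n : ℕ} (hn : 2 ≤ n) : coneConst n ≤ sigma 2 1 := by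
  refine (coneConst_le_coneConst_two hn).trans (coneConst_two_le.trans ?_)
  refine le_csInf (sigma_set_nonempty 2 1) ?_
  rintro s ⟨K, hK, rfl⟩
  exact pi_div_le_kSymmetry K hK

theorem sigma_sub_one_le_sigma_two_one {n : ℕ} (hn : 2 ≤ n) : sigma n (n - 1) ≤ sigma 2 1 := by
  induction n, hn using Nat.le_induction with
  | base => exact le_rfl
  | succ n hn ih =>
    have h := sigma_succ_le_max (n := n) (by omega) (n - 1)
    rw [Nat.sub_add_cancel (by omega)] at h
    exact h.trans (max_le (coneConst_le_sigma_two_one hn) ih)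

end MaximalEllipse

theorem theorem2 (n k : ℕ) (hn : 2 ≤ n) (hk : k < n) :
    sigma (n + 1) (k + 1) ≤
        max (((2 : ℝ) - (2 : ℝ) ^ (-(1 / (n : ℝ)))) ^ (-(n : ℤ))) (sigma n k) ∧
      sigma n (n - 1) ≤ sigma 2 1 ∧
      sigma 2 1 ≤ (1 / 3) * (Real.sqrt 2 + 1) :=
  ⟨sigma_succ_le_max (by omega) k, sigma_sub_one_le_sigma_two_one hn, sigma_two_one_le⟩
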